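/- **Setting.** Let $T=2(L+1)$ with $L\ge 1$, let $n_u,n_y\ge 1$, and let outputs be generated by $x_1=0$, $x_{t+1}=A^*x_t+B^*u_t$, $y_t=C^*x_t+\zeta_t$ ($1\le t\le T$), a linear system of some order $n_x^*$ with zero feed-through. For matrices $(A,B,C)$ let $G(A,B,C)\in\mathbb R^{Tn_y\times Tn_u}$ be the block matrix with $(i,j)$ block $CA^{i-j-1}B$ if $i>j$ and $0$ otherwise, and put $G^*=G(A^*,B^*,C^*)$. *Data.* In one rollout $U=(u_1,\dots,u_T)$ the inputs $u_t$ are independent, centred, with covariance $\Sigma_U$, and sub-Gaussian: $\mathbb E\,e^{s\langle u_t,v\rangle}\le e^{s^2\sigma_U^2/(2n_u)}$ for all unit $v$ and all $s\in\mathbb R$. Conditionally on $u_1,\dots,u_t,\zeta_1,\dots,\zeta_{t-1}$, the noise $\zeta_t$ is sub-Gaussian with proxy variance $\sigma^2/n_y$ in every unit direction. One observes $N$ i.i.d. rollouts $(U_i,Y_i)$. Put $\tilde\Sigma_U=I_T\otimes\Sigma_U$. *Parameters.* For $\theta=(a,B,C)$ of order $n$ ($a\in\mathbb R^{n}$, $b_j\in\mathbb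 R^{n_u}$ the rows of $B$, $c_j\in\mathbb R^{n_y}$ the columns of $C$) write $G(\theta)=G(\mathrm{diag}(a),B,C)$ and $\Theta(\theta)=\sum_{j=1}^{n}\gamma(a_j)\|b_j\|_2\|c_j\|_2$ with $\gamma(a)=\sum_{t=0}^{L}a^{2t}$. Let $\mathcal F$ be the set of all $\theta$, of any order $n\in\mathbb N$, with $|a_j|\le B_a$, $\|b_j\|_2\le B_b$, $\|c_j\|_2\le B_c$ for all $j$. Assume that for every $n$ and all $\theta,\theta'\in\mathcal F$ of order $n$ $$\|G(\theta')-G(\theta)\|_2\le k_a\sqrt n\,\big[\|a'-a\|_2+\|B'-B\|_F+\|C'-C\|_F\big].$$ Define $\Omega(G^*)=\inf\{\Theta(\theta):\theta\in\mathcal F,\ G(\theta)=G^*\}\in[0,\infty]$ ($=\infty$ if there is no such $\theta$) and $$\mathsf{cond}_{\mathcal F}=\sup_{\theta\in\mathcal F}\ \sup_{1\le t\le T}\frac{\sqrt{\mathbb E\|E_tG(\theta)\mathrm{vec}(U)\|^4}}{\mathbb E\|E_tG(\theta)\mathrm{vec}(U)\|^2}\qquad(0/0:=0),$$ where $E_t$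 selects the $t$-th block of $n_y$ rows. *Program.* For $\lambda\ge0$ consider, over $\theta=(a,B,C)$ of all orders, $$\min_{\theta}\ \frac1{4N(L+1)}\sum_{i=1}^N\|\mathrm{vec}(Y_i)-G(\theta)\mathrm{vec}(U_i)\|_2^2+\lambda\,\Theta(\theta).$$ Call $\hat\theta=(\hat a,\hat B,\hat C)\in\mathcal F$ a global optimum if no element of $\mathcal F$ (of any order) has a smaller objective value; every unrestricted minimizer that lies in $\mathcal F$ is one. **Theorem.** For every $C_\lambda>0$ and $\alpha_\lambda\ge 0$ there are $C>0$, $\alpha\ge0$ (depending only on $C_\lambda,\alpha_\lambda$), and for all $\sigma,\sigma_U,B_a,B_b,B_c,k_a>0$ there is $c>0$ (depending only on these numbers and $C_\lambda,\alpha_\lambda$), such that the following holds for all $L,N,n_u,n_y$ with $NL\ge2$, all $\lambda\ge 0$, all $\delta\in(0,1]$, and all systems and data laws as above. With probability at least $1-\delta$, every global optimum $\hat\theta$ whose order $n_x\ge1$ satisfies $$\lambda\le C_\lambda\,\frac{n_x(n_y+n_u)+\ln(1/\delta)}{NL}\,(\ln(NL))^{\alpha_\lambda},\qquad \frac{N}{\ln(NL)}\ge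 c\,\mathsf{cond}_{\mathcal F}^2\,\big[n_x(n_y+n_u)+\ln(1/\delta)\big]$$ obeys $$\frac1{2(L+1)}\big\|(G(\hat\theta)-G^*)\tilde\Sigma_U^{1/2}\big\|_F^2\le C\,\big(\sigma^2+\Omega(G^*)\big)\,\frac{n_x(n_y+n_u)+\ln(1/\delta)}{NL}\,(\ln(NL))^{\alpha}.$$ Here "with probability at least $1-\delta$" means that the exceptional event has outer probability at most $\delta$. In particular the constants do not depend on $L$. -/

import Mathlib

open MeasureTheory ProbabilityTheory
open scoped ENNReal NNReal Kronecker Matrix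

noncomputable section

namespace SysId

/-- Column vectors with the Euclidean norm. -/
abbrev Vec (n : ℕ) := EuclideanSpace ℝ (Fin n)

/-- The time indices of one trajectory of length `2(L+1)` (the time `t` is the index `t - 1`). -/
abbrev Time (L : ℕ) := Fin (2 * (L + 1))

/-- The randomness of one rollout: the inputs and the output noise. -/
abbrev Rollout (L nu ny : ℕ) := (Time L → Vec nu) × (Time L → Vec ny)

/-! ### The linear system and its impulse response -/

/-- Hidden states: `x` at the first time is `0`, and `x` at time `k+1` is `A x + B u` at time `k`. -/
def state {nx nu L : ℕ} (A : Matrix (Fin nx) (Fin nx) ℝ) (B : Matrix (Fin nx) (Fin nu) ℝ)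
    (u : Time L → Vec nu) : ℕ → (Fin nx → ℝ)
  | 0 => 0
  | k + 1 => A *ᵥ state A B u k + if h : k < 2 * (L + 1) then B *ᵥ (u ⟨k, h⟩).ofLp else 0

/-- Outputs `y = C x + ζ` (the feed-through matrix is zero). -/
def output {nx nu ny L : ℕ} (A : Matrix (Fin nx) (Fin nx) ℝ) (B : Matrix (Fin nx) (Fin nu) ℝ)
    (C : Matrix (Fin ny) (Fin nx) ℝ) (r : Rollout L nu ny) (t : Time L) : Vec ny :=
  WithLp.toLp 2 (C *ᵥ state A B r.1 t) + r.2 t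

/-- The impulse response `G(A, B, C)`: a block matrix whose `(i, j)` block is `C A^(i-j-1) B` if
`i > j` and `0` otherwise. -/
def impulse {nx nu ny : ℕ} (L : ℕ) (A : Matrix (Fin nx) (Fin nx) ℝ)
    (B : Matrix (Fin nx) (Fin nu) ℝ) (C : Matrix (Fin ny) (Fin nx) ℝ) :
    Matrix (Time L × Fin ny) (Time L × Fin nu) ℝ :=
  Matrix.of fun p q =>
    if q.1 < p.1 then (C * A ^ ((p.1 : ℕ) - (q.1 : ℕ) - 1) * B) p.2 q.2 else 0

/-- The `t`-th block `E_t G vec(u)` of the response of `G` to the inputs `u`. -/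
def response {nu ny L : ℕ} (G : Matrix (Time L × Fin ny) (Time L × Fin nu) ℝ)
    (u : Time L → Vec nu) (t : Time L) : Vec ny :=
  WithLp.toLp 2 fun k => (G *ᵥ fun q : Time L × Fin nu => u q.1 q.2) (t, k)

/-! ### Norms and the square root of the input covariance -/

/-- Squared Frobenius norm. -/
def frobSq {m n : Type*} [Fintype m] [Fintype n] (M : Matrix m n ℝ) : ℝ :=
  ∑ i, ∑ j, M i j ^ 2

section
open scoped Matrix.Norms.L2Operator MatrixOrder

/-- Spectral norm (the operator norm with respect to Euclidean norms). -/
def specNorm {m n : Type*} [Fintype m] [Fintype n] [DecidableEq n] (M : Matrix m n ℝ) : ℝ := ‖M‖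

/-- The positive semidefinite square root of `I ⊗ S`, with `I` the identity of size `2(L+1)`. -/
def covSqrt {nu : ℕ} (L : ℕ) (S : Matrix (Fin nu) (Fin nu) ℝ) :
    Matrix (Time L × Fin nu) (Time L × Fin nu) ℝ :=
  CFC.sqrt ((1 : Matrix (Time L) (Time L) ℝ) ⊗ₖ S)

end

/-! ### Diagonal systems: parameters, regularizer, parameter class -/

/-- Parameters of a diagonal system of order `n`: the diagonal `a` of the state matrix, the rows
`b j` of `B`, and the columns `c j` of `C`. -/
structure DiagParam (n nu ny : ℕ) where
  a : Fin n → ℝ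
  b : Fin n → Vec nu
  c : Fin n → Vec ny

namespace DiagParam

variable {n nu ny : ℕ}

def matB (θ : DiagParam n nu ny) : Matrix (Fin n) (Fin nu) ℝ := Matrix.of fun j k => θ.b j k

def matC (θ : DiagParam n nu ny) : Matrix (Fin ny) (Fin n) ℝ := Matrix.of fun k j => θ.c j k

/-- `G(diag(a), B, C)`. -/
def G (L : ℕ) (θ : DiagParam n nu ny) : Matrix (Time L × Fin ny) (Time L × Fin nu) ℝ :=
  impulse L (Matrix.diagonal θ.a) θ.matB θ.matC

/-- The regularizer `Θ(a, B, C) = ∑ j, γ(a j) ‖b j‖ ‖c j‖` with `γ(a) = ∑_{t=0}^{L} a^(2t)`. -/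
def reg (L : ℕ) (θ : DiagParam n nu ny) : ℝ :=
  ∑ j, (∑ t ∈ Finset.range (L + 1), θ.a j ^ (2 * t)) * ‖θ.b j‖ * ‖θ.c j‖

/-- Membership in the class `F` of bounded parameters. -/
def Bounded (Ba Bb Bc : ℝ) (θ : DiagParam n nu ny) : Prop :=
  ∀ j, |θ.a j| ≤ Ba ∧ ‖θ.b j‖ ≤ Bb ∧ ‖θ.c j‖ ≤ Bc

end DiagParam

/-- Lipschitz continuity of the impulse response on the class of bounded parameters, for every
order `n`, with constant `ka √n`. -/
def LipschitzClass (L nu ny : ℕ) (Ba Bb Bc ka : ℝ) : Prop :=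
  ∀ (n : ℕ) (θ θ' : DiagParam n nu ny), θ.Bounded Ba Bb Bc → θ'.Bounded Ba Bb Bc →
    specNorm (θ'.G L - θ.G L) ≤ ka * √n *
      (√(∑ j, (θ'.a j - θ.a j) ^ 2) + √(frobSq (θ'.matB - θ.matB))
        + √(frobSq (θ'.matC - θ.matC)))

/-- The optimal regularizer: the least value of the regularizer over the representations of `G` by
bounded parameters of any order (`∞` if there is none). -/
def optReg {nu ny : ℕ} (L : ℕ) (Ba Bb Bc : ℝ)
    (G : Matrix (Time L × Fin ny) (Time L × Fin nu) ℝ) : ℝ≥0∞ :=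
  ⨅ (n : ℕ) (θ : DiagParam n nu ny) (_ : θ.Bounded Ba Bb Bc) (_ : θ.G L = G),
    ENNReal.ofReal (θ.reg L)

/-- The condition number of the class: the supremum, over bounded parameters of any order and all
times `t`, of `√(E ‖E_t G(θ) vec(U)‖⁴) / E ‖E_t G(θ) vec(U)‖²` (where `0 / 0 = 0`), for a rollout
with law `ρ`. -/
def condNum {L nu ny : ℕ} (Ba Bb Bc : ℝ) (ρ : Measure (Rollout L nu ny)) : ℝ≥0∞ :=
  ⨆ (n : ℕ) (θ : DiagParam n nu ny) (_ : θ.Bounded Ba Bb Bc) (t : Time L),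
    (∫⁻ r, ‖response (θ.G L) r.1 t‖ₑ ^ 4 ∂ρ) ^ (1 / 2 : ℝ)
      / ∫⁻ r, ‖response (θ.G L) r.1 t‖ₑ ^ 2 ∂ρ

/-! ### Data model -/

/-- The inputs up to and including time `t`, and the noise strictly before time `t`. -/
def pastMap {L nu ny : ℕ} (t : Time L) (r : Rollout L nu ny) :
    ({s : Time L // s ≤ t} → Vec nu) × ({s : Time L // s < t} → Vec ny) :=
  (fun s => r.1 s, fun s => r.2 s)

/-- The σ-algebra generated by the inputs up to time `t` and the noise strictly before `t`. -/
@[reducible] def past {L nu ny : ℕ} (t : Time L) : MeasurableSpace (Rollout L nu ny) :=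
  MeasurableSpace.comap (pastMap t) inferInstance

theorem past_le {L nu ny : ℕ} (t : Time L) :
    past t ≤ (inferInstance : MeasurableSpace (Rollout L nu ny)) := by
  apply Measurable.comap_le
  unfold pastMap
  fun_prop

/-- The law `ρ` of one rollout: independent, centred inputs with covariance `S` that are
sub-Gaussian with proxy variance `σU² / nu`, and noise that, given the inputs up to the current
time and the earlier noise, is sub-Gaussian with proxy variance `σ² / ny`. -/
structure DataModel {L nu ny : ℕ} (σ σU : ℝ) (S : Matrix (Fin nu) (Fin nu) ℝ)
    (ρ : Measure (Rollout L nu ny)) [IsProbabilityMeasure ρ] : Prop where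
  indep : iIndepFun (fun (t : Time L) (r : Rollout L nu ny) => r.1 t) ρ
  mean_zero : ∀ (t : Time L) (k : Fin nu), ∫ r, r.1 t k ∂ρ = 0
  cov_eq : ∀ (t : Time L) (k l : Fin nu),
    cov[fun r : Rollout L nu ny => r.1 t k, fun r => r.1 t l; ρ] = S k l
  input_subG : ∀ (t : Time L) (v : Vec nu), ‖v‖ = 1 →
    HasSubgaussianMGF (fun r : Rollout L nu ny => inner ℝ (r.1 t) v) (σU ^ 2 / nu).toNNReal ρ
  noise_subG : ∀ (t : Time L) (w : Vec ny), ‖w‖ = 1 →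
    HasCondSubgaussianMGF (past t) (past_le t)
      (fun r : Rollout L nu ny => inner ℝ (r.2 t) w) (σ ^ 2 / ny).toNNReal ρ

/-! ### The program -/

/-- The objective `1/(4N(L+1)) ∑ i, ‖vec(Y i) - G(diag(a), B, C) vec(U i)‖² + lam Θ(a, B, C)`. -/
def objective {L nu ny N n : ℕ} (lam : ℝ) (U : Fin N → Time L → Vec nu)
    (Y : Fin N → Time L → Vec ny) (θ : DiagParam n nu ny) : ℝ :=
  1 / (4 * N * (L + 1)) * ∑ i, ∑ t, ‖Y i t - response (θ.G L) (U i) t‖ ^ 2 + lam * θ.reg L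

/-- `θ` lies in the class of bounded parameters and no element of that class, of any order, has a
smaller objective. In particular, this holds for each `θ` in the class that is a minimizer among
all parameters. -/
def IsGlobalOpt {L nu ny N n : ℕ} (Ba Bb Bc lam : ℝ) (U : Fin N → Time L → Vec nu)
    (Y : Fin N → Time L → Vec ny) (θ : DiagParam n nu ny) : Prop :=
  θ.Bounded Ba Bb Bc ∧
    ∀ (n' : ℕ) (θ' : DiagParam n' nu ny), θ'.Bounded Ba Bb Bc →
      objective lam U Y θ ≤ objective lam U Y θ'

/-- `n (ny + nu) + ln(1/δ)`. -/
def complexity (n nu ny : ℕ) (δ : ℝ) : ℝ := n * (ny + nu) + Real.log (1 / δ)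

end SysId

end

/-! Write `G*` for the true impulse response, `D = G(θ̂) - G*`, `m` for `complexity` and `ℓ =
ln(NL)`. The proof is a basic inequality combined with two one-sided concentration bounds on a
finite net, one net for each order `n`.

Comparing the objective at `θ̂` with that at any bounded representation `θs` of `G*` gives
`totalEnergy D ≤ 2 noisePairing D + 4N(L+1) λ Θ(θs)` (`IsGlobalOpt.totalEnergy_le`). The claim is
about the mean energy, because `‖D Σ̃^(1/2)‖_F²` is the expected energy of one rollout
(`frobSq_mul_covSqrt`).

Lower isometry: systems of all orders are admitted, so `D` is itself the response of a bounded
diagonal system, the parallel connection `diff`, and the condition number applies to it. Minkowski's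
inequality in `L²` turns the ratios at the single times into `E energy² ≤ cond² (E energy)²` without
a factor depending on `L`. A nonnegative variable with this property has an exponential lower tail,
hence `totalEnergy ≥ N/2 · E energy` except with probability `exp(-N/(8 cond²))`.

Noise: the response of a strictly causal matrix at time `t` is measurable with respect to the past,
so an exponential supermartingale yields the self-normalized bound `noisePairing ≤ totalEnergy/4 +
(2σ²/ny) x` except with probability `exp(-x)`. The quarter of the energy is absorbed by the left
side of the basic inequality, and no bound on the size of `D` is needed.

Both bounds hold on a net of mesh polynomial in `1/(NL)`, with at most `exp(14 m ℓ)` points, so `x =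
18 m ℓ` suffices. Off the net, crude bounds on the total energies of inputs and noise control the
discretization error; they cost only logarithms of `NL`. Order `n` receives failure probability
`δ/2^n`; summing over orders and taking the infimum over `θs` finishes the proof. -/

namespace SysId

/-! ### Exponential moments of sub-Gaussian vectors -/

/-- A bound on exponential moments extends from a dense set of directions to all directions. -/
theorem lintegral_exp_inner_le_of_dense {Ω : Type*} [MeasurableSpace Ω] {n : ℕ} {ν : Measure Ω}
    {ξ : Ω → Vec n} (hξ : Measurable ξ) {v : ℝ} {D : Set (Vec n)} (hD : Dense D)
    (h : ∀ g ∈ D, ∫⁻ ω, ENNReal.ofReal (Real.exp (inner ℝ (ξ ω) g)) ∂ν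
      ≤ ENNReal.ofReal (Real.exp (v * ‖g‖ ^ 2 / 2))) (g : Vec n) :
    ∫⁻ ω, ENNReal.ofReal (Real.exp (inner ℝ (ξ ω) g)) ∂ν
      ≤ ENNReal.ofReal (Real.exp (v * ‖g‖ ^ 2 / 2)) := by
  obtain ⟨u, huD, hu⟩ := mem_closure_iff_seq_limit.1 (hD g)
  have h1 : ∀ ω, Filter.liminf (fun k => ENNReal.ofReal (Real.exp (inner ℝ (ξ ω) (u k))))
      Filter.atTop = ENNReal.ofReal (Real.exp (inner ℝ (ξ ω) g)) := fun ω =>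
    Filter.Tendsto.liminf_eq <| (ENNReal.continuous_ofReal.tendsto _).comp <|
      (Real.continuous_exp.tendsto _).comp <| tendsto_const_nhds.inner hu
  have h2 : Filter.Tendsto (fun k => ENNReal.ofReal (Real.exp (v * ‖u k‖ ^ 2 / 2))) Filter.atTop
      (nhds (ENNReal.ofReal (Real.exp (v * ‖g‖ ^ 2 / 2)))) := by
    have : Continuous fun x : Vec n => ENNReal.ofReal (Real.exp (v * ‖x‖ ^ 2 / 2)) :=
      ENNReal.continuous_ofReal.comp (by fun_prop)
    exact (this.tendsto g).comp hu
  -- Fatou's lemma along a sequence in `D` converging to `g`; no domination is needed.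
  calc _ = ∫⁻ ω, (Filter.liminf (fun k => ENNReal.ofReal (Real.exp (inner ℝ (ξ ω) (u k))))
      Filter.atTop) ∂ν := by simp_rw [h1]
    _ ≤ Filter.liminf (fun k => ∫⁻ ω, ENNReal.ofReal (Real.exp (inner ℝ (ξ ω) (u k))) ∂ν)
      Filter.atTop := lintegral_liminf_le fun k => by fun_prop
    _ ≤ Filter.liminf (fun k => ENNReal.ofReal (Real.exp (v * ‖u k‖ ^ 2 / 2))) Filter.atTop :=
      Filter.liminf_le_liminf (Filter.Eventually.of_forall fun k => h _ (huD k))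
    _ = _ := h2.liminf_eq

/-- The exponential moment in a direction whose normalization is sub-Gaussian. -/
theorem lintegral_exp_inner_le_of_normalized {Ω : Type*} [MeasurableSpace Ω] {n : ℕ}
    {ν : Measure Ω} [IsProbabilityMeasure ν] {ξ : Ω → Vec n} {v : ℝ} (hv : 0 ≤ v) (g : Vec n)
    (h : HasSubgaussianMGF (fun ω => inner ℝ (ξ ω) (‖g‖⁻¹ • g)) v.toNNReal ν) :
    ∫⁻ ω, ENNReal.ofReal (Real.exp (inner ℝ (ξ ω) g)) ∂ν
      ≤ ENNReal.ofReal (Real.exp (v * ‖g‖ ^ 2 / 2)) := by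
  have key : ∀ ω, inner ℝ (ξ ω) g = ‖g‖ * inner ℝ (ξ ω) (‖g‖⁻¹ • g) := fun ω => by
    rcases eq_or_ne g 0 with rfl | hg
    · simp
    · rw [inner_smul_right, ← mul_assoc, mul_inv_cancel₀ (norm_ne_zero_iff.2 hg), one_mul]
  simp_rw [key]
  rw [← ofReal_integral_eq_lintegral_ofReal (h.integrable_exp_mul ‖g‖)
    (ae_of_all _ fun _ => (Real.exp_pos _).le)]
  have := h.mgf_le ‖g‖
  rw [Real.coe_toNNReal v hv] at this
  exact ENNReal.ofReal_le_ofReal this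

theorem norm_inv_smul_self {n : ℕ} {g : Vec n} (hg : g ≠ 0) : ‖‖g‖⁻¹ • g‖ = 1 := by
  rw [norm_smul, norm_inv, norm_norm, inv_mul_cancel₀ (norm_ne_zero_iff.2 hg)]

theorem lintegral_exp_inner_le {Ω : Type*} [MeasurableSpace Ω] {n : ℕ}
    {ν : Measure Ω} [IsProbabilityMeasure ν] {ξ : Ω → Vec n} {v : ℝ} (hv : 0 ≤ v)
    (h : ∀ w : Vec n, ‖w‖ = 1 → HasSubgaussianMGF (fun ω => inner ℝ (ξ ω) w) v.toNNReal ν)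
    (g : Vec n) :
    ∫⁻ ω, ENNReal.ofReal (Real.exp (inner ℝ (ξ ω) g)) ∂ν
      ≤ ENNReal.ofReal (Real.exp (v * ‖g‖ ^ 2 / 2)) := by
  rcases eq_or_ne g 0 with rfl | hg
  · simp
  · exact lintegral_exp_inner_le_of_normalized hv g (h _ (norm_inv_smul_self hg))

/-- A conditionally sub-Gaussian vector, paired with a random direction that is measurable with
respect to the conditioning σ-algebra, satisfies the supermartingale inequality. -/
theorem lintegral_mul_exp_inner_sub_le {Ω : Type*} {m mΩ : MeasurableSpace Ω}
    [StandardBorelSpace Ω] {hm : m ≤ mΩ} {μ : Measure Ω} [IsProbabilityMeasure μ] {n : ℕ}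
    {ξ : Ω → Vec n} (hξ : Measurable ξ) {v : ℝ} (hv : 0 ≤ v)
    (h : ∀ w : Vec n, ‖w‖ = 1 →
      HasCondSubgaussianMGF m hm (fun ω => inner ℝ (ξ ω) w) v.toNNReal μ)
    {Z : Ω → ℝ≥0∞} (hZ : Measurable[m] Z) {g : Ω → Vec n} (hg : Measurable[m] g) :
    ∫⁻ ω, Z ω * ENNReal.ofReal (Real.exp (inner ℝ (ξ ω) (g ω) - v * ‖g ω‖ ^ 2 / 2)) ∂μ
      ≤ ∫⁻ ω, Z ω ∂μ := by
  set D := TopologicalSpace.denseSeq (Vec n)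
  have hae : ∀ᵐ ω ∂(μ.trim hm), ∀ g : Vec n,
      ∫⁻ ω', ENNReal.ofReal (Real.exp (inner ℝ (ξ ω') g)) ∂(condExpKernel μ m ω)
        ≤ ENNReal.ofReal (Real.exp (v * ‖g‖ ^ 2 / 2)) := by
    -- The conditional bound holds off a null set that depends on the direction. Countably many
    -- directions share one null set, and density then covers all directions, so that the random
    -- direction `g ω` may be inserted.
    have : ∀ᵐ ω ∂(μ.trim hm), ∀ k,
        ∫⁻ ω', ENNReal.ofReal (Real.exp (inner ℝ (ξ ω') (D k))) ∂(condExpKernel μ m ω)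
          ≤ ENNReal.ofReal (Real.exp (v * ‖D k‖ ^ 2 / 2)) := by
      refine ae_all_iff.2 fun k => ?_
      rcases eq_or_ne (D k) 0 with h0 | h0
      · simp [h0]
      · have hk := h _ (norm_inv_smul_self h0)
        filter_upwards [hk.mgf_le, Kernel.HasSubgaussianMGF.ae_forall_integrable_exp_mul hk]
          with ω h1 h2
        exact lintegral_exp_inner_le_of_normalized hv _ ⟨h2, h1⟩
    filter_upwards [this] with ω hω g
    refine lintegral_exp_inner_le_of_dense hξ (TopologicalSpace.denseRange_denseSeq (Vec n)) ?_ g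
    rintro _ ⟨k, rfl⟩
    exact hω k
  -- The `m`-measurable quantities sit on the first coordinate and `ξ` on the second. Disintegrating
  -- the diagonal law along `condExpKernel` freezes `Z` and `g` while `ξ` is integrated out.
  let F : Ω × Ω → ℝ≥0∞ := fun p =>
    Z p.1 * (ENNReal.ofReal (Real.exp (-(v * ‖g p.1‖ ^ 2 / 2)))
      * ENNReal.ofReal (Real.exp (inner ℝ (ξ p.2) (g p.1))))
  have hF : Measurable[m.prod mΩ] F := by
    have h1 : @Measurable (Ω × Ω) Ω (m.prod mΩ) m Prod.fst := @measurable_fst Ω Ω m mΩ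
    have h2 : @Measurable (Ω × Ω) Ω (m.prod mΩ) mΩ Prod.snd := @measurable_snd Ω Ω m mΩ
    have h3 := hZ.comp h1
    have h4 := hg.comp h1
    have h5 := hξ.comp h2
    have hc : Continuous fun q : Vec n × Vec n => (inner ℝ q.1 q.2 : ℝ) := continuous_inner
    have h6 : Measurable[m.prod mΩ] fun p : Ω × Ω =>
        ENNReal.ofReal (Real.exp (inner ℝ (ξ p.2) (g p.1))) :=
      (Real.measurable_exp.comp (hc.measurable.comp (h5.prodMk h4))).ennreal_ofReal
    have hc' : Continuous fun x : Vec n => Real.exp (-(v * ‖x‖ ^ 2 / 2)) := by fun_prop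
    have h7 : Measurable[m.prod mΩ] fun p : Ω × Ω =>
        ENNReal.ofReal (Real.exp (-(v * ‖g p.1‖ ^ 2 / 2))) :=
      (hc'.measurable.comp h4).ennreal_ofReal
    exact h3.fun_mul (h7.fun_mul h6)
  have hdiag : @Measurable Ω (Ω × Ω) mΩ (m.prod mΩ) Function.diag :=
    Measurable.prodMk (measurable_id'' hm) measurable_id
  have e1 : ∫⁻ ω, Z ω * ENNReal.ofReal (Real.exp (inner ℝ (ξ ω) (g ω) - v * ‖g ω‖ ^ 2 / 2)) ∂μ
      = ∫⁻ ω, F (ω, ω) ∂μ := by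
    refine lintegral_congr fun ω => ?_
    simp only [F]
    rw [← ENNReal.ofReal_mul (Real.exp_pos _).le, ← Real.exp_add, neg_add_eq_sub]
  have e2 : ∫⁻ ω, F (ω, ω) ∂μ
      = ∫⁻ ω, ∫⁻ ω', F (ω, ω') ∂(condExpKernel μ m ω) ∂(μ.trim hm) := by
    rw [← Measure.lintegral_compProd hF, compProd_trim_condExpKernel,
      @lintegral_map Ω (Ω × Ω) mΩ (m.prod mΩ) _ _ _ hF hdiag]
    rfl
  rw [e1, e2, ← lintegral_trim hm hZ]
  refine lintegral_mono_ae ?_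
  filter_upwards [hae] with ω hω
  simp only [F]
  rw [lintegral_const_mul _ (by fun_prop), lintegral_const_mul _ (by fun_prop)]
  refine mul_le_of_le_one_right' ?_
  refine (mul_le_mul_right (hω (g ω)) _).trans ?_
  rw [← ENNReal.ofReal_mul (Real.exp_pos _).le, ← Real.exp_add, neg_add_cancel]
  simp

/-! ### Tail bounds for independent copies -/

/-- Chernoff bound for a sum over independent copies. -/
theorem pi_measure_sum_ge_le {E : Type*} [MeasurableSpace E] (ρ : Measure E)
    [IsProbabilityMeasure ρ] (N : ℕ) {h : E → ℝ} (hh : Measurable h) (x : ℝ) :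
    (Measure.pi fun _ : Fin N => ρ) {X | x ≤ ∑ i, h (X i)}
      ≤ ENNReal.ofReal (Real.exp (-x))
        * (∫⁻ e, ENNReal.ofReal (Real.exp (h e)) ∂ρ) ^ N := by
  have hm : Measurable fun e => ENNReal.ofReal (Real.exp (h e)) := by fun_prop
  have e1 : ∫⁻ X : Fin N → E, ∏ i, ENNReal.ofReal (Real.exp (h (X i)))
      ∂(Measure.pi fun _ : Fin N => ρ) = (∫⁻ e, ENNReal.ofReal (Real.exp (h e)) ∂ρ) ^ N := by
    rw [lintegral_prod_eq_prod_lintegral_of_indepFun Finset.univ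
      (fun i (X : Fin N → E) => ENNReal.ofReal (Real.exp (h (X i))))
      (iIndepFun_pi (X := fun _ e => ENNReal.ofReal (Real.exp (h e))) fun i => hm.aemeasurable)
      (fun i => hm.comp (measurable_pi_apply i))]
    have : ∀ i : Fin N, ∫⁻ X : Fin N → E, ENNReal.ofReal (Real.exp (h (X i)))
        ∂(Measure.pi fun _ : Fin N => ρ) = ∫⁻ e, ENNReal.ofReal (Real.exp (h e)) ∂ρ := fun i =>
      (measurePreserving_eval (fun _ : Fin N => ρ) i).lintegral_comp hm
    simp [this]
  rw [← e1, ← lintegral_const_mul _ (by fun_prop), ← one_mul (Measure.pi _ _)]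
  refine (mul_le_mul_right (measure_mono ?_) 1).trans (mul_meas_ge_le_lintegral (by fun_prop) 1)
  intro X hX
  simp only [Set.mem_ofPred_eq] at hX ⊢
  rw [← ENNReal.ofReal_prod_of_nonneg fun i _ => (Real.exp_pos _).le, ← Real.exp_sum,
    ← ENNReal.ofReal_mul (Real.exp_pos _).le, ← Real.exp_add, ENNReal.one_le_ofReal]
  exact Real.one_le_exp (by linarith)

/-- One-sided lower tail for sums of independent copies of a nonnegative variable whose second
moment is controlled by its mean. -/
theorem pi_measure_sum_le_half_mean {E : Type*} [MeasurableSpace E] (ρ : Measure E)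
    [IsProbabilityMeasure ρ] (N : ℕ) {Z : E → ℝ} (hZ : Measurable Z) (hZ0 : ∀ e, 0 ≤ Z e)
    (hi : Integrable Z ρ) (hi2 : Integrable (fun e => Z e ^ 2) ρ) {κ : ℝ} (hκ : 0 < κ)
    (hvar : ∫ e, Z e ^ 2 ∂ρ ≤ κ * (∫ e, Z e ∂ρ) ^ 2) :
    (Measure.pi fun _ : Fin N => ρ) {X | ∑ i, Z (X i) < N / 2 * ∫ e, Z e ∂ρ}
      ≤ ENNReal.ofReal (Real.exp (-(N / (8 * κ)))) := by
  set m := ∫ e, Z e ∂ρ with hmdef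
  have hm0 : 0 ≤ m := integral_nonneg hZ0
  rcases hm0.eq_or_lt with h0 | hpos
  · have : {X : Fin N → E | ∑ i, Z (X i) < N / 2 * m} = ∅ := by
      ext X
      simp only [← h0, mul_zero, Set.mem_ofPred_eq, Set.mem_empty_iff_false, iff_false, not_lt]
      exact Finset.sum_nonneg fun i _ => hZ0 _
    rw [this]; simp
  -- This `s` minimizes the Chernoff exponent `-s m / 2 + s² κ m² / 2`, whose minimum is `-1 / (8
  -- κ)`.
  set s := 1 / (2 * κ * m) with hs
  have hspos : 0 < s := by positivity
  -- It holds because `(1 + y + y²/2)(1 - y + y²/2) = 1 + y⁴/4 ≥ 1`. Only `y ≥ 0` occurs, so two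
  -- moments suffice for the lower tail.
  have hexp : ∀ y : ℝ, 0 ≤ y → Real.exp (-y) ≤ 1 - y + y ^ 2 / 2 := fun y hy => by
    have h1 : 1 + y + y ^ 2 / 2 ≤ Real.exp y := Real.quadratic_le_exp_of_nonneg hy
    have h2 : 0 < 1 - y + y ^ 2 / 2 := by nlinarith [sq_nonneg (y - 1)]
    rw [Real.exp_neg, inv_le_comm₀ (Real.exp_pos _) h2]
    refine le_trans ?_ h1
    rw [inv_le_iff_one_le_mul₀ h2]
    nlinarith [sq_nonneg (y ^ 2)]
  have hL : ∫⁻ e, ENNReal.ofReal (Real.exp (-(s * Z e))) ∂ρ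
      ≤ ENNReal.ofReal (Real.exp (-(s * m) + s ^ 2 * (κ * m ^ 2) / 2)) := by
    have hint : Integrable (fun e => 1 - s * Z e + (s * Z e) ^ 2 / 2) ρ := by
      refine ((integrable_const 1).sub (hi.const_mul s)).add ?_
      simp_rw [mul_pow]
      exact (hi2.const_mul _).div_const 2
    calc _ ≤ ∫⁻ e, ENNReal.ofReal (1 - s * Z e + (s * Z e) ^ 2 / 2) ∂ρ :=
          lintegral_mono fun e => ENNReal.ofReal_le_ofReal (hexp _ (mul_nonneg hspos.le (hZ0 e)))
      _ = ENNReal.ofReal (∫ e, (1 - s * Z e + (s * Z e) ^ 2 / 2) ∂ρ) := by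
          refine (ofReal_integral_eq_lintegral_ofReal hint (ae_of_all _ fun e => ?_)).symm
          exact (Real.exp_pos _).le.trans (hexp _ (mul_nonneg hspos.le (hZ0 e)))
      _ ≤ _ := by
          refine ENNReal.ofReal_le_ofReal ?_
          have : ∫ e, (1 - s * Z e + (s * Z e) ^ 2 / 2) ∂ρ
              = 1 - s * m + s ^ 2 * (∫ e, Z e ^ 2 ∂ρ) / 2 := by
            have hq : Integrable (fun e => (s * Z e) ^ 2 / 2) ρ := by
              simp_rw [mul_pow]
              exact (hi2.const_mul _).div_const 2
            have hl : Integrable (fun e => 1 - s * Z e) ρ :=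
              (integrable_const 1).sub (hi.const_mul s)
            rw [integral_add hl hq, integral_sub (integrable_const 1) (hi.const_mul s)]
            simp_rw [mul_pow]
            rw [integral_div, integral_const_mul, integral_const_mul]
            simp [hmdef]
          rw [this]
          have h3 : s ^ 2 * (∫ e, Z e ^ 2 ∂ρ) ≤ s ^ 2 * (κ * m ^ 2) := by gcongr
          linarith [Real.add_one_le_exp (-(s * m) + s ^ 2 * (κ * m ^ 2) / 2)]
  have hsub : {X : Fin N → E | ∑ i, Z (X i) < N / 2 * m}
      ⊆ {X | -(s * (N / 2 * m)) ≤ ∑ i, -(s * Z (X i))} := by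
    intro X hX
    simp only [Set.mem_ofPred_eq] at hX ⊢
    rw [Finset.sum_neg_distrib, ← Finset.mul_sum]
    exact neg_le_neg (mul_le_mul_of_nonneg_left hX.le hspos.le)
  refine (measure_mono hsub).trans ((pi_measure_sum_ge_le ρ N (h := fun e => -(s * Z e))
    (by fun_prop) _).trans ?_)
  refine (mul_le_mul_right (pow_le_pow_left' hL N) _).trans ?_
  rw [← ENNReal.ofReal_pow (Real.exp_pos _).le, ← ENNReal.ofReal_mul (Real.exp_pos _).le,
    ← Real.exp_nat_mul, ← Real.exp_add]
  refine ENNReal.ofReal_le_ofReal (Real.exp_le_exp.2 (le_of_eq ?_))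
  have : s * m = 1 / (2 * κ) := by rw [hs]; field_simp
  have h2 : s ^ 2 * (κ * m ^ 2) = 1 / (4 * κ) := by
    rw [show s ^ 2 * (κ * m ^ 2) = (s * m) ^ 2 * κ by ring, this]; field_simp; norm_num
  rw [h2, show s * (N / 2 * m) = N / 2 * (s * m) by ring, this]
  field_simp
  ring

/-- Tail bound for a coordinate of a sub-Gaussian vector. -/
theorem measure_abs_coord_gt_le {Ω : Type*} [MeasurableSpace Ω] {n : ℕ} {ν : Measure Ω}
    {ξ : Ω → Vec n} (hξ : Measurable ξ) {v : ℝ} (hv : 0 < v)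
    (h : ∀ g : Vec n, ∫⁻ ω, ENNReal.ofReal (Real.exp (inner ℝ (ξ ω) g)) ∂ν
      ≤ ENNReal.ofReal (Real.exp (v * ‖g‖ ^ 2 / 2))) (k : Fin n) {y : ℝ} (hy : 0 ≤ y) :
    ν {ω | 2 * v * y < (ξ ω k) ^ 2} ≤ ENNReal.ofReal (2 * Real.exp (-y)) := by
  have one : ∀ ε : ℝ, ε ^ 2 = 1 → ν {ω | √(2 * v * y) ≤ ε * ξ ω k}
      ≤ ENNReal.ofReal (Real.exp (-y)) := fun ε hε => by
    set r := √(2 * v * y)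
    have hr : r ^ 2 = 2 * v * y := Real.sq_sqrt (by positivity)
    have hr0 : 0 ≤ r := Real.sqrt_nonneg _
    -- Optimal Chernoff parameter: the exponent is `r²/(2v) - r²/v = -y`.
    have hg := h (EuclideanSpace.single k (ε * r / v))
    have e1 : ∀ ω, inner ℝ (ξ ω) (EuclideanSpace.single k (ε * r / v)) = ε * r / v * ξ ω k :=
      fun ω => by simp [EuclideanSpace.inner_single_right]
    have e2 : v * ‖(EuclideanSpace.single k (ε * r / v) : Vec n)‖ ^ 2 / 2 = y := by
      rw [PiLp.norm_single, Real.norm_eq_abs, sq_abs, div_pow, mul_pow, hε, hr]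
      field_simp
    simp_rw [e1, e2] at hg
    rw [← one_mul (ν _)]
    have hsub : {ω | r ≤ ε * ξ ω k} ⊆ {ω | 1 ≤ ENNReal.ofReal (Real.exp (-(2 * y)))
        * ENNReal.ofReal (Real.exp (ε * r / v * ξ ω k))} := by
      intro ω hω
      simp only [Set.mem_ofPred_eq] at hω ⊢
      rw [← ENNReal.ofReal_mul (Real.exp_pos _).le, ← Real.exp_add, ENNReal.one_le_ofReal]
      refine Real.one_le_exp ?_
      have : 2 * y ≤ ε * r / v * ξ ω k := by
        rw [show 2 * y = r * r / v by rw [← sq, hr]; field_simp,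
          show ε * r / v * ξ ω k = r * (ε * ξ ω k) / v by ring]
        gcongr
      linarith
    refine (mul_le_mul_right (measure_mono hsub) 1).trans
      ((mul_meas_ge_le_lintegral (by fun_prop) 1).trans ?_)
    rw [lintegral_const_mul _ (by fun_prop)]
    refine (mul_le_mul_right hg _).trans ?_
    rw [← ENNReal.ofReal_mul (Real.exp_pos _).le, ← Real.exp_add]
    exact ENNReal.ofReal_le_ofReal (Real.exp_le_exp.2 (by linarith))
  have hsub : {ω | 2 * v * y < (ξ ω k) ^ 2}
      ⊆ {ω | √(2 * v * y) ≤ 1 * ξ ω k} ∪ {ω | √(2 * v * y) ≤ -1 * ξ ω k} := by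
    intro ω hω
    have := Real.abs_le_sqrt (le_refl (ξ ω k ^ 2))
    have h2 : √(2 * v * y) ≤ |ξ ω k| := by
      rw [← Real.sqrt_sq_eq_abs]; exact Real.sqrt_le_sqrt (le_of_lt hω)
    rcases le_abs.1 h2 with h3 | h3
    · left; simpa using h3
    · right; simpa using h3
  refine (measure_mono hsub).trans ((measure_union_le _ _).trans ?_)
  rw [two_mul (Real.exp (-y)), ENNReal.ofReal_add (Real.exp_pos _).le (Real.exp_pos _).le]
  exact add_le_add (one 1 (by norm_num)) (one (-1) (by norm_num))

/-- Second moments of the coordinates of a sub-Gaussian vector. -/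
theorem lintegral_coord_sq_le {Ω : Type*} [MeasurableSpace Ω] {n : ℕ} {ν : Measure Ω}
    {ξ : Ω → Vec n} (hξ : Measurable ξ) {v : ℝ} (hv : 0 < v)
    (h : ∀ g : Vec n, ∫⁻ ω, ENNReal.ofReal (Real.exp (inner ℝ (ξ ω) g)) ∂ν
      ≤ ENNReal.ofReal (Real.exp (v * ‖g‖ ^ 2 / 2))) (k : Fin n) :
    ∫⁻ ω, ENNReal.ofReal (ξ ω k ^ 2) ∂ν ≤ ENNReal.ofReal (8 * v) := by
  set s := (√v)⁻¹
  have hs : s ^ 2 = v⁻¹ := by rw [inv_pow, Real.sq_sqrt hv.le]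
  have one : ∀ ε : ℝ, ε ^ 2 = 1 → ∫⁻ ω, ENNReal.ofReal (Real.exp (ε * s * ξ ω k)) ∂ν
      ≤ ENNReal.ofReal (Real.exp (1 / 2)) := fun ε hε => by
    have hg := h (EuclideanSpace.single k (ε * s))
    have e1 : ∀ ω, inner ℝ (ξ ω) (EuclideanSpace.single k (ε * s)) = ε * s * ξ ω k :=
      fun ω => by simp [EuclideanSpace.inner_single_right]
    have e2 : v * ‖(EuclideanSpace.single k (ε * s) : Vec n)‖ ^ 2 / 2 = 1 / 2 := by
      rw [PiLp.norm_single, Real.norm_eq_abs, sq_abs, mul_pow, hε, hs]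
      field_simp
    simp_rw [e1, e2] at hg
    exact hg
  have pt : ∀ x : ℝ, x ^ 2 ≤ 2 * v * (Real.exp (1 * s * x) + Real.exp (-1 * s * x)) := fun x => by
    have h1 : (s * x) ^ 2 ≤ 2 * (Real.exp (s * x) + Real.exp (-(s * x))) := by
      have h3 := Real.quadratic_le_exp_of_nonneg (abs_nonneg (s * x))
      have h4 := Real.exp_abs_le (s * x)
      rw [sq_abs] at h3
      linarith [abs_nonneg (s * x)]
    rw [mul_pow, hs] at h1
    have h2 := mul_le_mul_of_nonneg_left h1 hv.le
    rw [← mul_assoc, mul_inv_cancel₀ hv.ne', one_mul] at h2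
    rw [one_mul, neg_one_mul, neg_mul]
    linarith
  calc _ ≤ ∫⁻ ω, ENNReal.ofReal (2 * v) * (ENNReal.ofReal (Real.exp (1 * s * ξ ω k))
        + ENNReal.ofReal (Real.exp (-1 * s * ξ ω k))) ∂ν := by
        refine lintegral_mono fun ω => ?_
        rw [← ENNReal.ofReal_add (Real.exp_pos _).le (Real.exp_pos _).le,
          ← ENNReal.ofReal_mul (by positivity)]
        exact ENNReal.ofReal_le_ofReal (pt _)
    _ ≤ ENNReal.ofReal (2 * v) * (ENNReal.ofReal (Real.exp (1 / 2))
        + ENNReal.ofReal (Real.exp (1 / 2))) := by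
        rw [lintegral_const_mul _ (by fun_prop), lintegral_add_left (by fun_prop)]
        exact mul_le_mul_right (add_le_add (one 1 (by norm_num)) (one (-1) (by norm_num))) _
    _ ≤ _ := by
        rw [← ENNReal.ofReal_add (Real.exp_pos _).le (Real.exp_pos _).le,
          ← ENNReal.ofReal_mul (by positivity)]
        refine ENNReal.ofReal_le_ofReal ?_
        have h2 : Real.exp (1 / 2) ≤ 2 := by
          have h1 : Real.exp (1 / 2) ^ 2 = Real.exp 1 := by
            rw [← Real.exp_nat_mul]; norm_num
          nlinarith [Real.exp_one_lt_d9, Real.exp_pos (1 / 2)]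
        nlinarith

/-! ### Responses of block matrices -/

section Response

variable {nu ny L : ℕ}

theorem response_apply (G : Matrix (Time L × Fin ny) (Time L × Fin nu) ℝ)
    (u : Time L → Vec nu) (t : Time L) (k : Fin ny) :
    response G u t k = ∑ q : Time L × Fin nu, G (t, k) q * u q.1 q.2 := rfl

theorem response_sub (G H : Matrix (Time L × Fin ny) (Time L × Fin nu) ℝ)
    (u : Time L → Vec nu) (t : Time L) :
    response (G - H) u t = response G u t - response H u t := by
  ext k
  simp [response_apply, sub_mul]

theorem state_eq_sum {nx : ℕ} (A : Matrix (Fin nx) (Fin nx) ℝ) (B : Matrix (Fin nx) (Fin nu) ℝ)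
    (u : Time L → Vec nu) (k : ℕ) :
    state A B u k = ∑ s : Time L,
      if (s : ℕ) < k then (A ^ (k - s - 1) * B) *ᵥ (u s).ofLp else 0 := by
  induction k with
  | zero => simp [state]
  | succ k ih =>
    have e : ∀ s : Time L,
        (if (s : ℕ) < k + 1 then (A ^ (k + 1 - s - 1) * B) *ᵥ (u s).ofLp else 0)
        = A *ᵥ (if (s : ℕ) < k then (A ^ (k - s - 1) * B) *ᵥ (u s).ofLp else 0)
          + if (s : ℕ) = k then B *ᵥ (u s).ofLp else 0 := fun s => by
      rcases lt_trichotomy (s : ℕ) k with h | h | h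
      · rw [if_pos (by omega), if_pos h, if_neg (by omega), add_zero, Matrix.mulVec_mulVec,
          ← Matrix.mul_assoc, ← pow_succ', show k + 1 - (s : ℕ) - 1 = k - s - 1 + 1 by omega]
      · rw [if_pos (by omega), if_neg (by omega), if_pos h, h]
        simp
      · rw [if_neg (by omega), if_neg (by omega), if_neg (by omega)]
        simp
    rw [state, ih, Finset.sum_congr rfl fun s _ => e s, Finset.sum_add_distrib,
      Matrix.mulVec_sum]
    congr 1
    split_ifs with h
    · rw [Finset.sum_eq_single (⟨k, h⟩ : Time L)]
      · simp
      · intro s _ hs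
        rw [if_neg fun h' => hs (Fin.ext h')]
      · simp
    · refine (Finset.sum_eq_zero fun s _ => ?_).symm
      rw [if_neg]
      have := s.2
      omega

/-- Links the state recursion to the block matrix: the residual of the true system is exactly the
noise. -/
theorem output_eq {nx : ℕ} (A : Matrix (Fin nx) (Fin nx) ℝ) (B : Matrix (Fin nx) (Fin nu) ℝ)
    (C : Matrix (Fin ny) (Fin nx) ℝ) (r : Rollout L nu ny) (t : Time L) :
    output A B C r t = response (impulse L A B C) r.1 t + r.2 t := by
  unfold output
  congr 1
  ext k
  simp only [response_apply, impulse, Matrix.of_apply, state_eq_sum, Fintype.sum_prod_type]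
  rw [Matrix.mulVec_sum, Finset.sum_apply]
  refine Finset.sum_congr rfl fun s _ => ?_
  by_cases h : s < t
  · simp only [Fin.lt_def.1 h, if_true, h]
    rw [Matrix.mulVec_mulVec, ← Matrix.mul_assoc]
    rfl
  · simp [h]

/-- Energy of the response to the inputs `u`. -/
noncomputable def energy (G : Matrix (Time L × Fin ny) (Time L × Fin nu) ℝ) (u : Time L → Vec nu) : ℝ :=
  ∑ t, ‖response G u t‖ ^ 2

theorem energy_nonneg (G : Matrix (Time L × Fin ny) (Time L × Fin nu) ℝ) (u : Time L → Vec nu) :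
    0 ≤ energy G u := Finset.sum_nonneg fun _ _ => by positivity

theorem energy_eq (G : Matrix (Time L × Fin ny) (Time L × Fin nu) ℝ) (u : Time L → Vec nu) :
    energy G u = ∑ p, (∑ q : Time L × Fin nu, G p q * u q.1 q.2) ^ 2 := by
  simp only [energy, EuclideanSpace.norm_sq_eq, response_apply, Real.norm_eq_abs, sq_abs,
    Fintype.sum_prod_type]

open scoped Matrix.Norms.L2Operator in
theorem energy_le (G : Matrix (Time L × Fin ny) (Time L × Fin nu) ℝ) (u : Time L → Vec nu) :
    energy G u ≤ specNorm G ^ 2 * ∑ t, ‖u t‖ ^ 2 := by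
  have h := Matrix.l2_opNorm_mulVec G (WithLp.toLp 2 fun q : Time L × Fin nu => u q.1 q.2)
  have h2 := pow_le_pow_left₀ (norm_nonneg _) h 2
  rw [mul_pow, EuclideanSpace.norm_sq_eq, EuclideanSpace.norm_sq_eq] at h2
  simp only [Real.norm_eq_abs, sq_abs] at h2
  rw [energy_eq]
  refine h2.trans (le_of_eq ?_)
  simp only [EuclideanSpace.norm_sq_eq, Real.norm_eq_abs, sq_abs, Fintype.sum_prod_type]
  rfl

/-- The block matrix only propagates strictly earlier inputs. -/
def StrictlyCausal (G : Matrix (Time L × Fin ny) (Time L × Fin nu) ℝ) : Prop :=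
  ∀ p q, ¬ q.1 < p.1 → G p q = 0

theorem strictlyCausal_impulse {nx : ℕ} (A : Matrix (Fin nx) (Fin nx) ℝ)
    (B : Matrix (Fin nx) (Fin nu) ℝ) (C : Matrix (Fin ny) (Fin nx) ℝ) :
    StrictlyCausal (impulse L A B C) := fun p q h => by
  simp [impulse, h]

theorem StrictlyCausal.sub {G H : Matrix (Time L × Fin ny) (Time L × Fin nu) ℝ}
    (hG : StrictlyCausal G) (hH : StrictlyCausal H) : StrictlyCausal (G - H) := fun p q h => by
  simp [hG p q h, hH p q h]

theorem measurable_past_noise {s t : Time L} (h : s < t) :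
    Measurable[past t] fun r : Rollout L nu ny => r.2 s := by
  have h1 : Measurable fun x : ({s : Time L // s ≤ t} → Vec nu) × ({s : Time L // s < t} → Vec ny)
      => x.2 ⟨s, h⟩ := by fun_prop
  exact h1.comp (comap_measurable (pastMap t))


theorem past_mono {s t : Time L} (h : s ≤ t) :
    (past s : MeasurableSpace (Rollout L nu ny)) ≤ past t := by
  refine Measurable.comap_le ?_
  have h1 : Measurable fun x : ({s : Time L // s ≤ t} → Vec nu) × ({s : Time L // s < t} → Vec ny)
      => ((fun i => x.1 ⟨i.1, i.2.trans h⟩, fun i => x.2 ⟨i.1, i.2.trans_le h⟩) :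
        ({i : Time L // i ≤ s} → Vec nu) × ({i : Time L // i < s} → Vec ny)) := by fun_prop
  exact h1.comp (comap_measurable (pastMap t))

/-- Causality is what makes the response a predictable multiplier of the noise. Later inputs may
depend on the present noise, so a general block matrix would not do. -/
theorem StrictlyCausal.measurable_response
    {G : Matrix (Time L × Fin ny) (Time L × Fin nu) ℝ} (hG : StrictlyCausal G) (t : Time L) :
    Measurable[past t] fun r : Rollout L nu ny => response G r.1 t := by
  have h1 : Measurable fun x : ({s : Time L // s ≤ t} → Vec nu) × ({s : Time L // s < t} → Vec ny)
      => (WithLp.toLp 2 fun k => ∑ q : Time L × Fin nu,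
        if h : q.1 ≤ t then G (t, k) q * x.1 ⟨q.1, h⟩ q.2 else 0 : Vec ny) := by
    refine (WithLp.measurable_toLp 2 _).comp (measurable_pi_lambda _ fun k => ?_)
    refine Finset.measurable_sum _ fun q _ => ?_
    split_ifs
    · fun_prop
    · fun_prop
  have h2 : (fun r : Rollout L nu ny => response G r.1 t) =
      (fun x : ({s : Time L // s ≤ t} → Vec nu) × ({s : Time L // s < t} → Vec ny)
      => (WithLp.toLp 2 fun k => ∑ q : Time L × Fin nu,
        if h : q.1 ≤ t then G (t, k) q * x.1 ⟨q.1, h⟩ q.2 else 0 : Vec ny)) ∘ pastMap t := by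
    funext r
    ext k
    simp only [response_apply, Function.comp_apply, pastMap]
    refine Finset.sum_congr rfl fun q _ => ?_
    split_ifs with h
    · rfl
    · rw [hG (t, k) q fun h' => h h'.le, zero_mul]
  rw [h2]
  exact h1.comp (comap_measurable (pastMap t))

theorem measurable_response (G : Matrix (Time L × Fin ny) (Time L × Fin nu) ℝ) (t : Time L) :
    Measurable fun r : Rollout L nu ny => response G r.1 t := by
  refine (WithLp.measurable_toLp 2 _).comp (measurable_pi_lambda _ fun k => ?_)
  simp only [Matrix.mulVec, dotProduct]
  fun_prop

theorem measurable_energy (G : Matrix (Time L × Fin ny) (Time L × Fin nu) ℝ) :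
    Measurable fun r : Rollout L nu ny => energy G r.1 :=
  Finset.measurable_sum _ fun t _ => ((measurable_response G t).norm).pow_const 2

/-- Exponential supermartingale inequality for noise that is conditionally sub-Gaussian. -/
theorem lintegral_exp_sum_inner_sub_le_one {ρ : Measure (Rollout L nu ny)}
    [IsProbabilityMeasure ρ] {v : ℝ} (hv : 0 ≤ v)
    (hn : ∀ (t : Time L) (w : Vec ny), ‖w‖ = 1 → HasCondSubgaussianMGF (past t) (past_le t)
      (fun r : Rollout L nu ny => inner ℝ (r.2 t) w) v.toNNReal ρ)
    {g : Time L → Rollout L nu ny → Vec ny} (hg : ∀ t, Measurable[past t] (g t)) :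
    ∫⁻ r, ENNReal.ofReal (Real.exp (∑ t, (inner ℝ (r.2 t) (g t r) - v * ‖g t r‖ ^ 2 / 2))) ∂ρ
      ≤ 1 := by
  have hc : Continuous fun p : Vec ny × Vec ny =>
      (inner ℝ p.1 p.2 - v * ‖p.2‖ ^ 2 / 2 : ℝ) := by fun_prop
  have key : ∀ k, ∫⁻ r, ENNReal.ofReal (Real.exp (∑ t ∈ Finset.univ.filter (fun t : Time L => (t : ℕ) < k),
      (inner ℝ (r.2 t) (g t r) - v * ‖g t r‖ ^ 2 / 2))) ∂ρ ≤ 1 := by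
    intro k
    -- The latest time is integrated out first: all earlier factors are measurable with respect to
    -- its past, so the conditional bound for that one noise vector removes its factor.
    induction k with
    | zero => simp
    | succ k ih =>
      by_cases hk : k < 2 * (L + 1)
      · set t₀ : Time L := ⟨k, hk⟩ with ht₀
        have e : (Finset.univ.filter fun t : Time L => (t : ℕ) < k + 1)
            = insert t₀ (Finset.univ.filter fun t : Time L => (t : ℕ) < k) := by
          ext t
          simp only [Finset.mem_filter, Finset.mem_univ, true_and, Finset.mem_insert, Fin.ext_iff,
            ht₀]
          omega
        have hnot : t₀ ∉ Finset.univ.filter fun t : Time L => (t : ℕ) < k := by simp [ht₀]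
        refine le_trans (le_of_eq ?_) ((lintegral_mul_exp_inner_sub_le (hm := past_le t₀)
          (ξ := fun r : Rollout L nu ny => r.2 t₀) (by fun_prop) hv (hn t₀)
          (Z := fun r => ENNReal.ofReal (Real.exp (∑ t ∈ Finset.univ.filter (fun t : Time L => (t : ℕ) < k),
            (inner ℝ (r.2 t) (g t r) - v * ‖g t r‖ ^ 2 / 2)))) ?_ (hg t₀)).trans ih)
        · refine lintegral_congr fun r => ?_
          rw [e, Finset.sum_insert hnot, ← ENNReal.ofReal_mul (Real.exp_pos _).le, ← Real.exp_add,
            add_comm]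
        · refine (Real.measurable_exp.comp (Finset.measurable_sum _ fun t ht => ?_)).ennreal_ofReal
          have htk : t < t₀ := by simpa [Fin.lt_def, ht₀] using ht
          exact hc.measurable.comp ((measurable_past_noise htk).prodMk
            ((hg t).mono (past_mono htk.le) le_rfl))
      · have e : (Finset.univ.filter fun t : Time L => (t : ℕ) < k + 1)
            = Finset.univ.filter fun t : Time L => (t : ℕ) < k := by
          ext t
          have := t.2
          simp only [Finset.mem_filter, Finset.mem_univ, true_and]
          omega
        rwa [e]
  have := key (2 * (L + 1))
  simpa using this

end Response

/-! ### Diagonal systems -/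

namespace DiagParam

variable {n n' nu ny : ℕ}

theorem G_apply (L : ℕ) (θ : DiagParam n nu ny) (p : Time L × Fin ny) (q : Time L × Fin nu) :
    θ.G L p q = if q.1 < p.1 then
      ∑ j, θ.c j p.2 * θ.a j ^ ((p.1 : ℕ) - (q.1 : ℕ) - 1) * θ.b j q.2 else 0 := by
  simp only [G, impulse, Matrix.of_apply, Matrix.diagonal_pow]
  rw [Matrix.mul_apply]
  simp only [Matrix.mul_diagonal]
  rfl

theorem strictlyCausal_G (L : ℕ) (θ : DiagParam n nu ny) : StrictlyCausal (θ.G L) :=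
  strictlyCausal_impulse _ _ _

theorem reg_nonneg (L : ℕ) (θ : DiagParam n nu ny) : 0 ≤ θ.reg L :=
  Finset.sum_nonneg fun j _ => mul_nonneg (mul_nonneg (Finset.sum_nonneg fun t _ => by
    rw [pow_mul]; positivity) (norm_nonneg _)) (norm_nonneg _)

/-- The parallel connection of `θ` with the negative of `θ'`. -/
def diff (θ : DiagParam n nu ny) (θ' : DiagParam n' nu ny) : DiagParam (n + n') nu ny where
  a := Fin.append θ.a θ'.a
  b := Fin.append θ.b θ'.b
  c := Fin.append θ.c fun j => -θ'.c j

/-- Parallel connection adds impulse responses, and the sign is carried by the columns of `C`. Since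
the class contains every order, differences stay in it, and moment bounds for the class apply to
estimation errors. -/
theorem G_diff (L : ℕ) (θ : DiagParam n nu ny) (θ' : DiagParam n' nu ny) :
    (θ.diff θ').G L = θ.G L - θ'.G L := by
  ext p q
  rw [Matrix.sub_apply, G_apply, G_apply, G_apply]
  split_ifs
  · simp [diff, Fin.sum_univ_add, sub_eq_add_neg]
  · simp

theorem Bounded.diff {Ba Bb Bc : ℝ} {θ : DiagParam n nu ny} {θ' : DiagParam n' nu ny}
    (h : θ.Bounded Ba Bb Bc) (h' : θ'.Bounded Ba Bb Bc) : (θ.diff θ').Bounded Ba Bb Bc := by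
  intro j
  refine Fin.addCases (fun j => ?_) (fun j => ?_) j
  · simpa [DiagParam.diff] using h j
  · simpa [DiagParam.diff] using h' j

end DiagParam

/-! ### Rounding to a finite net -/

/-- Integer part, rounded toward zero. -/
noncomputable def roundZero (x : ℝ) : ℤ := if 0 ≤ x then ⌊x⌋ else ⌈x⌉

theorem abs_roundZero_le (x : ℝ) : |(roundZero x : ℝ)| ≤ |x| := by
  unfold roundZero
  split_ifs with h
  · rw [abs_of_nonneg h, abs_of_nonneg (by exact_mod_cast Int.floor_nonneg.2 h)]
    exact Int.floor_le x
  · have h' : x ≤ 0 := (not_le.1 h).le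
    rw [abs_of_nonpos h', abs_of_nonpos (by exact_mod_cast Int.ceil_nonpos.2 h')]
    exact neg_le_neg (Int.le_ceil x)

theorem abs_sub_roundZero_le (x : ℝ) : |x - roundZero x| ≤ 1 := by
  unfold roundZero
  split_ifs with h
  · rw [abs_le]; constructor <;> linarith [Int.floor_le x, Int.lt_floor_add_one x]
  · rw [abs_le]; constructor <;> linarith [Int.le_ceil x, Int.ceil_lt_add_one x]

/-- Indices of the net: one integer in `[-K, K]` (shifted by `K`) for each coordinate. -/
abbrev NetIndex (n nu ny K : ℕ) := Fin n × (Unit ⊕ Fin nu ⊕ Fin ny) → Fin (2 * K + 1)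

/-- The point of the net with mesh `η` and index `z`. -/
noncomputable def netParam {n nu ny K : ℕ} (η : ℝ) (z : NetIndex n nu ny K) :
    DiagParam n nu ny where
  a j := η * ((z (j, .inl ()) : ℕ) - K)
  b j := WithLp.toLp 2 fun k => η * ((z (j, .inr (.inl k)) : ℕ) - K)
  c j := WithLp.toLp 2 fun k => η * ((z (j, .inr (.inr k)) : ℕ) - K)

theorem card_netIndex (n nu ny K : ℕ) :
    Fintype.card (NetIndex n nu ny K) = (2 * K + 1) ^ (n * (1 + (nu + ny))) := by
  simp

theorem exists_shifted_roundZero {η x B : ℝ} (hη : 0 < η) (hx : |x| ≤ B) :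
    ∃ z : Fin (2 * ⌊B / η⌋₊ + 1), (roundZero (x / η) : ℝ) = (z : ℕ) - (⌊B / η⌋₊ : ℝ) := by
  have h1 : |(roundZero (x / η) : ℝ)| ≤ B / η :=
    (abs_roundZero_le _).trans (by rw [abs_div, abs_of_pos hη]; gcongr)
  have h2 : (roundZero (x / η)).natAbs ≤ ⌊B / η⌋₊ := by
    refine Nat.le_floor ?_
    rw [Nat.cast_natAbs]
    exact_mod_cast h1
  refine ⟨⟨(roundZero (x / η) + ⌊B / η⌋₊).toNat, by omega⟩, ?_⟩
  have h3 : (((roundZero (x / η) + ⌊B / η⌋₊).toNat : ℤ)) = roundZero (x / η) + ⌊B / η⌋₊ :=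
    Int.toNat_of_nonneg (by omega)
  have h4 : (((roundZero (x / η) + ⌊B / η⌋₊).toNat : ℝ)) = roundZero (x / η) + ⌊B / η⌋₊ := by
    exact_mod_cast h3
  simp only [h4]
  ring

/-- Rounding toward zero never enlarges a coordinate, so the net point remains bounded; rounding to
the nearest grid point could leave the class. -/
theorem abs_mul_roundZero_le {η : ℝ} (hη : 0 < η) (x : ℝ) : |η * roundZero (x / η)| ≤ |x| := by
  rw [abs_mul, abs_of_pos hη]
  calc η * |(roundZero (x / η) : ℝ)| ≤ η * |x / η| :=
        mul_le_mul_of_nonneg_left (abs_roundZero_le _) hη.le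
    _ = |x| := by rw [abs_div, abs_of_pos hη]; field_simp

theorem sq_sub_mul_roundZero_le {η : ℝ} (hη : 0 < η) (x : ℝ) :
    (x - η * roundZero (x / η)) ^ 2 ≤ η ^ 2 := by
  rw [show x - η * roundZero (x / η) = η * (x / η - roundZero (x / η)) by field_simp, mul_pow]
  have := abs_sub_roundZero_le (x / η)
  rw [← sq_abs (x / η - _)]
  have h1 := pow_le_pow_left₀ (abs_nonneg _) this 2
  nlinarith [sq_nonneg η]

/-- Each bounded parameter has a bounded point of the net nearby. -/
theorem exists_netParam {n nu ny : ℕ} {Ba Bb Bc B η : ℝ} (hη : 0 < η) (ha : Ba ≤ B)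
    (hb : Bb ≤ B) (hc : Bc ≤ B) {θ : DiagParam n nu ny} (hθ : θ.Bounded Ba Bb Bc) :
    ∃ z : NetIndex n nu ny ⌊B / η⌋₊, (netParam η z).Bounded Ba Bb Bc ∧
      ∑ j, (θ.a j - (netParam η z).a j) ^ 2 ≤ n * η ^ 2 ∧
      frobSq (θ.matB - (netParam η z).matB) ≤ n * nu * η ^ 2 ∧
      frobSq (θ.matC - (netParam η z).matC) ≤ n * ny * η ^ 2 := by
  have hb' : ∀ j k, |θ.b j k| ≤ B := fun j k =>
    (PiLp.norm_apply_le (θ.b j) k).trans ((hθ j).2.1.trans hb)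
  have hc' : ∀ j k, |θ.c j k| ≤ B := fun j k =>
    (PiLp.norm_apply_le (θ.c j) k).trans ((hθ j).2.2.trans hc)
  choose za hza using fun j => exists_shifted_roundZero hη ((hθ j).1.trans ha)
  choose zb hzb using fun j k => exists_shifted_roundZero hη (hb' j k)
  choose zc hzc using fun j k => exists_shifted_roundZero hη (hc' j k)
  refine ⟨fun p => Sum.elim (fun _ => za p.1) (Sum.elim (zb p.1) (zc p.1)) p.2, ?_, ?_, ?_, ?_⟩
  · intro j
    refine ⟨?_, ?_, ?_⟩
    · simp only [netParam, Sum.elim_inl, ← hza]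
      exact (abs_mul_roundZero_le hη _).trans (hθ j).1
    · refine le_trans ?_ (hθ j).2.1
      rw [EuclideanSpace.norm_eq, EuclideanSpace.norm_eq]
      refine Real.sqrt_le_sqrt (Finset.sum_le_sum fun k _ => ?_)
      simp only [netParam, Sum.elim_inl, Sum.elim_inr, ← hzb, Real.norm_eq_abs]
      exact pow_le_pow_left₀ (abs_nonneg _) (abs_mul_roundZero_le hη _) 2
    · refine le_trans ?_ (hθ j).2.2
      rw [EuclideanSpace.norm_eq, EuclideanSpace.norm_eq]
      refine Real.sqrt_le_sqrt (Finset.sum_le_sum fun k _ => ?_)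
      simp only [netParam, Sum.elim_inr, ← hzc, Real.norm_eq_abs]
      exact pow_le_pow_left₀ (abs_nonneg _) (abs_mul_roundZero_le hη _) 2
  · refine (Finset.sum_le_sum fun j _ => ?_).trans (by simp : ∑ _j : Fin n, η ^ 2 ≤ _)
    simp only [netParam, Sum.elim_inl, ← hza]
    exact sq_sub_mul_roundZero_le hη _
  · refine (Finset.sum_le_sum fun j _ => Finset.sum_le_sum fun k _ => ?_).trans
      (by simp [mul_assoc] : ∑ _j : Fin n, ∑ _k : Fin nu, η ^ 2 ≤ _)
    simp only [netParam, Matrix.sub_apply, DiagParam.matB, Matrix.of_apply, Sum.elim_inl,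
      Sum.elim_inr, ← hzb]
    exact sq_sub_mul_roundZero_le hη _
  · refine (Finset.sum_le_sum fun k _ => Finset.sum_le_sum fun j _ => ?_).trans
      (by simp only [Finset.sum_const, Finset.card_univ, Fintype.card_fin, nsmul_eq_mul]
          exact le_of_eq (by ring) : ∑ _k : Fin ny, ∑ _j : Fin n, η ^ 2 ≤ _)
    simp only [netParam, Matrix.sub_apply, DiagParam.matC, Matrix.of_apply,
      Sum.elim_inr, ← hzc]
    exact sq_sub_mul_roundZero_le hη _

/-! ### Moments under the data model -/

section Response

variable {L nu ny : ℕ} {ρ : Measure (Rollout L nu ny)}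

theorem eLpNorm_sq_response (M : Matrix (Time L × Fin ny) (Time L × Fin nu) ℝ) (t : Time L) :
    eLpNorm (fun r : Rollout L nu ny => ‖response M r.1 t‖ ^ 2) 2 ρ
      = (∫⁻ r, ‖response M r.1 t‖ₑ ^ 4 ∂ρ) ^ (1 / 2 : ℝ) := by
  rw [eLpNorm_eq_lintegral_rpow_enorm_toReal (by norm_num) (by norm_num)]
  simp only [enorm_pow, enorm_norm, ENNReal.toReal_ofNat]
  congr 2
  funext r
  rw [← ENNReal.rpow_natCast, ← ENNReal.rpow_natCast, ← ENNReal.rpow_mul]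
  norm_num

theorem ratio_le_condNum {n : ℕ} {Ba Bb Bc : ℝ} {θ : DiagParam n nu ny}
    (hθ : θ.Bounded Ba Bb Bc) (t : Time L) :
    (∫⁻ r, ‖response (θ.G L) r.1 t‖ₑ ^ 4 ∂ρ) ^ (1 / 2 : ℝ)
      / ∫⁻ r, ‖response (θ.G L) r.1 t‖ₑ ^ 2 ∂ρ ≤ condNum Ba Bb Bc ρ := by
  unfold condNum
  exact le_iSup_of_le n (le_iSup_of_le θ (le_iSup_of_le hθ (le_iSup_of_le t le_rfl)))

theorem ofReal_energy (M : Matrix (Time L × Fin ny) (Time L × Fin nu) ℝ) (u : Time L → Vec nu) :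
    ENNReal.ofReal (energy M u) = ∑ t, ‖response M u t‖ₑ ^ 2 := by
  rw [energy, ENNReal.ofReal_sum_of_nonneg fun t _ => by positivity]
  refine Finset.sum_congr rfl fun t _ => ?_
  rw [ENNReal.ofReal_pow (norm_nonneg _), ofReal_norm]

theorem lintegral_energy (M : Matrix (Time L × Fin ny) (Time L × Fin nu) ℝ) :
    ∫⁻ r, ENNReal.ofReal (energy M r.1) ∂ρ = ∑ t, ∫⁻ r, ‖response M r.1 t‖ₑ ^ 2 ∂ρ := by
  simp_rw [ofReal_energy]
  exact lintegral_finsetSum _ fun t _ => (measurable_response M t).enorm.pow_const 2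

end Response

namespace DataModel

variable {L nu ny : ℕ} {σ σU : ℝ} {S : Matrix (Fin nu) (Fin nu) ℝ} {ρ : Measure (Rollout L nu ny)}
  [IsProbabilityMeasure ρ]

theorem lintegral_exp_input_le (hρ : DataModel σ σU S ρ) (t : Time L) (g : Vec nu) :
    ∫⁻ r, ENNReal.ofReal (Real.exp (inner ℝ (r.1 t) g)) ∂ρ
      ≤ ENNReal.ofReal (Real.exp (σU ^ 2 / nu * ‖g‖ ^ 2 / 2)) :=
  lintegral_exp_inner_le (by positivity) (hρ.input_subG t) g

/-- The unconditional bound is the supermartingale inequality for a fixed direction, with the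
constant `Z` chosen to cancel the compensator. -/
theorem lintegral_exp_noise_le (hρ : DataModel σ σU S ρ) (t : Time L) (g : Vec ny) :
    ∫⁻ r, ENNReal.ofReal (Real.exp (inner ℝ (r.2 t) g)) ∂ρ
      ≤ ENNReal.ofReal (Real.exp (σ ^ 2 / ny * ‖g‖ ^ 2 / 2)) := by
  have h := lintegral_mul_exp_inner_sub_le (hm := past_le t)
    (ξ := fun r : Rollout L nu ny => r.2 t) (by fun_prop) (by positivity) (hρ.noise_subG t)
    (Z := fun _ => ENNReal.ofReal (Real.exp (σ ^ 2 / ny * ‖g‖ ^ 2 / 2))) measurable_const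
    (g := fun _ => g) measurable_const
  simp_rw [← ENNReal.ofReal_mul (Real.exp_pos _).le, ← Real.exp_add, add_sub_cancel] at h
  simpa using h

theorem memLp_input (hρ : DataModel σ σU S ρ) (t : Time L) (k : Fin nu) (p : ℝ≥0) :
    MemLp (fun r : Rollout L nu ny => r.1 t k) p ρ := by
  have h := (hρ.input_subG t (EuclideanSpace.single k 1) (by simp)).memLp p
  simpa [EuclideanSpace.inner_single_right] using h

theorem integrable_input_mul (hρ : DataModel σ σU S ρ) (q q' : Time L × Fin nu) :
    Integrable (fun r : Rollout L nu ny => r.1 q.1 q.2 * r.1 q'.1 q'.2) ρ := by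
  have h : ∀ q : Time L × Fin nu, MemLp (fun r : Rollout L nu ny => r.1 q.1 q.2) 2 ρ :=
    fun q => hρ.memLp_input q.1 q.2 2
  exact (h q).integrable_mul (h q')

theorem integral_input_mul (hρ : DataModel σ σU S ρ) (q q' : Time L × Fin nu) :
    ∫ r, r.1 q.1 q.2 * r.1 q'.1 q'.2 ∂ρ = ((1 : Matrix (Time L) (Time L) ℝ) ⊗ₖ S) q q' := by
  obtain ⟨t, k⟩ := q
  obtain ⟨s, l⟩ := q'
  rw [Matrix.kroneckerMap_apply, Matrix.one_apply]
  split_ifs with h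
  · simp only at h
    subst h
    have := hρ.cov_eq t k l
    simpa [covariance, hρ.mean_zero] using this
  · have hi : IndepFun (fun r : Rollout L nu ny => r.1 t k) (fun r => r.1 s l) ρ :=
      (hρ.indep.indepFun h).comp (φ := fun x : Vec nu => x k) (ψ := fun x : Vec nu => x l)
        (by fun_prop) (by fun_prop)
    rw [hi.integral_fun_mul_eq_mul_integral (by fun_prop) (by fun_prop), hρ.mean_zero]
    simp

theorem integral_sq_sum_input (hρ : DataModel σ σU S ρ) (x : Time L × Fin nu → ℝ) :
    ∫ r, (∑ q : Time L × Fin nu, x q * r.1 q.1 q.2) ^ 2 ∂ρ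
      = ∑ q, ∑ q', x q * ((1 : Matrix (Time L) (Time L) ℝ) ⊗ₖ S) q q' * x q' := by
  have e : ∀ r : Rollout L nu ny, (∑ q : Time L × Fin nu, x q * r.1 q.1 q.2) ^ 2
      = ∑ q : Time L × Fin nu, ∑ q' : Time L × Fin nu,
        x q * x q' * (r.1 q.1 q.2 * r.1 q'.1 q'.2) := fun r => by
    rw [sq, Finset.sum_mul_sum]
    exact Finset.sum_congr rfl fun q _ => Finset.sum_congr rfl fun q' _ => by ring
  simp_rw [e]
  rw [integral_finsetSum _ fun q _ => integrable_finsetSum _ fun q' _ =>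
    (hρ.integrable_input_mul q q').const_mul _]
  refine Finset.sum_congr rfl fun q _ => ?_
  rw [integral_finsetSum _ fun q' _ => (hρ.integrable_input_mul q q').const_mul _]
  refine Finset.sum_congr rfl fun q' _ => ?_
  rw [integral_const_mul, hρ.integral_input_mul]
  ring

theorem posSemidef_cov (hρ : DataModel σ σU S ρ) :
    ((1 : Matrix (Time L) (Time L) ℝ) ⊗ₖ S).PosSemidef := by
  refine .of_dotProduct_mulVec_nonneg ?_ fun x => ?_
  · ext q q'
    rw [Matrix.conjTranspose_apply, star_trivial, ← hρ.integral_input_mul,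
      ← hρ.integral_input_mul]
    simp_rw [mul_comm]
  · have h : 0 ≤ ∫ r, (∑ q : Time L × Fin nu, x q * r.1 q.1 q.2) ^ 2 ∂ρ :=
      integral_nonneg fun r => sq_nonneg _
    rw [hρ.integral_sq_sum_input] at h
    simpa [dotProduct, Matrix.mulVec, Finset.mul_sum, mul_assoc] using h

theorem integrable_sq_sum_input (hρ : DataModel σ σU S ρ) (x : Time L × Fin nu → ℝ) :
    Integrable (fun r : Rollout L nu ny => (∑ q : Time L × Fin nu, x q * r.1 q.1 q.2) ^ 2) ρ := by
  have : MemLp (fun r : Rollout L nu ny => ∑ q : Time L × Fin nu, x q * r.1 q.1 q.2) 2 ρ :=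
    memLp_finsetSum _ fun q _ => (hρ.memLp_input q.1 q.2 2).const_mul _
  exact this.integrable_sq

theorem integrable_energy (hρ : DataModel σ σU S ρ)
    (M : Matrix (Time L × Fin ny) (Time L × Fin nu) ℝ) :
    Integrable (fun r : Rollout L nu ny => energy M r.1) ρ := by
  simp_rw [energy_eq]
  exact integrable_finsetSum _ fun p _ => hρ.integrable_sq_sum_input _

theorem integral_energy (hρ : DataModel σ σU S ρ)
    (M : Matrix (Time L × Fin ny) (Time L × Fin nu) ℝ) :
    ∫ r, energy M r.1 ∂ρ
      = ∑ p, ∑ q, ∑ q', M p q * ((1 : Matrix (Time L) (Time L) ℝ) ⊗ₖ S) q q' * M p q' := by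
  simp_rw [energy_eq]
  refine (integral_finsetSum _ fun p _ => hρ.integrable_sq_sum_input _).trans ?_
  exact Finset.sum_congr rfl fun p _ => hρ.integral_sq_sum_input _

open scoped Matrix.Norms.L2Operator MatrixOrder in
-- Independence and centring make `I ⊗ S` the second-moment matrix of the stacked input, and its
-- square root is symmetric with square `I ⊗ S`. The weighted Frobenius error is therefore the
-- population energy.
theorem frobSq_mul_covSqrt (hρ : DataModel σ σU S ρ)
    (M : Matrix (Time L × Fin ny) (Time L × Fin nu) ℝ) :
    frobSq (M * covSqrt L S) = ∫ r, energy M r.1 ∂ρ := by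
  set V := (1 : Matrix (Time L) (Time L) ℝ) ⊗ₖ S with hV
  set R := covSqrt L S with hR
  have hRR : R * R = V := CFC.sqrt_mul_sqrt_self V (Matrix.nonneg_iff_posSemidef.2 hρ.posSemidef_cov)
  have hRs : ∀ q q', R q q' = R q' q := fun q q' => by
    have h : R.IsHermitian := (Matrix.nonneg_iff_posSemidef.1 (CFC.sqrt_nonneg V)).isHermitian
    simpa using (h.apply q q').symm
  rw [hρ.integral_energy, frobSq, ← hV, ← hRR]
  refine Finset.sum_congr rfl fun p _ => ?_
  simp only [Matrix.mul_apply, sq, Finset.mul_sum, Finset.sum_mul]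
  rw [Finset.sum_comm]
  refine Finset.sum_congr rfl fun q _ => ?_
  rw [Finset.sum_comm]
  refine Finset.sum_congr rfl fun q' _ => Finset.sum_congr rfl fun s _ => ?_
  rw [hRs q' s]
  ring

theorem lintegral_sq_response_ne_top (hρ : DataModel σ σU S ρ)
    (M : Matrix (Time L × Fin ny) (Time L × Fin nu) ℝ) (t : Time L) :
    ∫⁻ r, ‖response M r.1 t‖ₑ ^ 2 ∂ρ ≠ ∞ := by
  have h : ∀ r : Rollout L nu ny, ‖response M r.1 t‖ₑ ^ 2 ≤ ‖energy M r.1‖ₑ := fun r => by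
    rw [Real.enorm_of_nonneg (energy_nonneg _ _), ← ofReal_norm,
      ← ENNReal.ofReal_pow (norm_nonneg _)]
    exact ENNReal.ofReal_le_ofReal (Finset.single_le_sum
      (f := fun t => ‖response M r.1 t‖ ^ 2) (fun _ _ => by positivity) (Finset.mem_univ t))
  exact ((lintegral_mono h).trans_lt (hρ.integrable_energy M).2).ne

variable {n : ℕ} {Ba Bb Bc : ℝ} {θ : DiagParam n nu ny}

theorem eLpNorm_sq_response_le (hρ : DataModel σ σU S ρ) (hθ : θ.Bounded Ba Bb Bc) (t : Time L) :
    eLpNorm (fun r : Rollout L nu ny => ‖response (θ.G L) r.1 t‖ ^ 2) 2 ρ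
      ≤ condNum Ba Bb Bc ρ * ∫⁻ r, ‖response (θ.G L) r.1 t‖ₑ ^ 2 ∂ρ := by
  by_cases h0 : ∫⁻ r, ‖response (θ.G L) r.1 t‖ₑ ^ 2 ∂ρ = 0
  · rw [lintegral_eq_zero_iff ((measurable_response _ t).enorm.pow_const 2)] at h0
    rw [eLpNorm_sq_response, ENNReal.rpow_eq_zero_iff.2 (Or.inl ⟨?_, by norm_num⟩)]
    · exact zero_le
    · rw [lintegral_eq_zero_iff ((measurable_response _ t).enorm.pow_const 4)]
      filter_upwards [h0] with r hr
      simp only [Pi.zero_apply, ne_eq, OfNat.ofNat_ne_zero, not_false_eq_true, pow_eq_zero_iff]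
        at hr ⊢
      exact hr
  · rw [eLpNorm_sq_response, ← ENNReal.div_le_iff h0 (hρ.lintegral_sq_response_ne_top _ t)]
    exact ratio_le_condNum hθ t

/-- Minkowski's inequality in `L²` over the times `t`: each summand has norm at most `condNum` times
its mean, and the means add up to the mean energy. No factor of the trajectory length appears. -/
theorem eLpNorm_energy_le (hρ : DataModel σ σU S ρ) (hθ : θ.Bounded Ba Bb Bc) :
    eLpNorm (fun r : Rollout L nu ny => energy (θ.G L) r.1) 2 ρ
      ≤ condNum Ba Bb Bc ρ * ENNReal.ofReal (∫ r, energy (θ.G L) r.1 ∂ρ) := by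
  have e : (fun r : Rollout L nu ny => energy (θ.G L) r.1)
      = ∑ t, fun r : Rollout L nu ny => ‖response (θ.G L) r.1 t‖ ^ 2 := by
    funext r
    rw [Finset.sum_apply]
    rfl
  rw [ofReal_integral_eq_lintegral_ofReal (hρ.integrable_energy _)
    (ae_of_all _ fun r => energy_nonneg _ _), lintegral_energy, e, Finset.mul_sum]
  refine (eLpNorm_sum_le (fun t _ => ?_) (by norm_num)).trans
    (Finset.sum_le_sum fun t _ => hρ.eLpNorm_sq_response_le hθ t)
  exact ((measurable_response (θ.G L) t).norm.pow_const 2).aestronglyMeasurable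

/-- The second moment of the energy is at most `condNum ^ 2` times its squared mean. -/
theorem integral_energy_sq_le (hρ : DataModel σ σU S ρ) (hθ : θ.Bounded Ba Bb Bc)
    (hcond : condNum Ba Bb Bc ρ ≠ ∞) :
    Integrable (fun r : Rollout L nu ny => energy (θ.G L) r.1 ^ 2) ρ ∧
    ∫ r, energy (θ.G L) r.1 ^ 2 ∂ρ
      ≤ (condNum Ba Bb Bc ρ).toReal ^ 2 * (∫ r, energy (θ.G L) r.1 ∂ρ) ^ 2 := by
  have hle := hρ.eLpNorm_energy_le hθ
  have hmem : MemLp (fun r : Rollout L nu ny => energy (θ.G L) r.1) 2 ρ :=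
    ⟨(measurable_energy _).aestronglyMeasurable,
      hle.trans_lt (ENNReal.mul_lt_top hcond.lt_top ENNReal.ofReal_lt_top)⟩
  refine ⟨hmem.integrable_sq, ?_⟩
  have h0 : 0 ≤ ∫ r, energy (θ.G L) r.1 ∂ρ := integral_nonneg fun r => energy_nonneg _ _
  have h1 := ENNReal.toReal_mono (ENNReal.mul_ne_top hcond ENNReal.ofReal_ne_top) hle
  rw [ENNReal.toReal_mul, ENNReal.toReal_ofReal h0,
    hmem.eLpNorm_eq_integral_rpow_norm (by norm_num) (by norm_num),
    ENNReal.toReal_ofReal (by positivity)] at h1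
  simp only [ENNReal.toReal_ofNat, Real.rpow_ofNat, Real.norm_eq_abs, sq_abs] at h1
  have hI : 0 ≤ ∫ r, energy (θ.G L) r.1 ^ 2 ∂ρ := integral_nonneg fun r => sq_nonneg _
  have h2 := pow_le_pow_left₀ (Real.rpow_nonneg hI _) h1 2
  rwa [← Real.rpow_natCast, ← Real.rpow_mul hI, mul_pow, Nat.cast_ofNat,
    inv_mul_cancel₀ (by norm_num), Real.rpow_one] at h2

/-- A condition number below `1` occurs only if all responses vanish. -/
theorem integral_energy_eq_zero (hρ : DataModel σ σU S ρ) (hθ : θ.Bounded Ba Bb Bc)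
    (hcond : condNum Ba Bb Bc ρ < 1) : ∫ r, energy (θ.G L) r.1 ∂ρ = 0 := by
  have h : ∀ t : Time L, ∫⁻ r, ‖response (θ.G L) r.1 t‖ₑ ^ 2 ∂ρ = 0 := fun t => by
    by_contra h0
    refine absurd ((ratio_le_condNum (ρ := ρ) hθ t).trans_lt hcond) (not_lt.2 ?_)
    rw [ENNReal.le_div_iff_mul_le (Or.inl h0) (Or.inl (hρ.lintegral_sq_response_ne_top _ t)),
      one_mul, ← eLpNorm_sq_response]
    -- On a probability space the `L¹` norm is at most the `L²` norm, so each ratio with nonzero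
    -- denominator is at least `1`.
    have h1 := eLpNorm_le_eLpNorm_of_exponent_le (μ := ρ) (p := 1) (q := 2) (by norm_num)
      ((measurable_response (θ.G L) t).norm.pow_const 2).aestronglyMeasurable
    rw [eLpNorm_one_eq_lintegral_enorm] at h1
    simpa [enorm_pow] using h1
  rw [integral_eq_lintegral_of_nonneg_ae (ae_of_all _ fun r => energy_nonneg _ _)
    (measurable_energy _).aestronglyMeasurable, lintegral_energy]
  simp [h]

/-- Second moment of the inputs. -/
theorem integral_sum_norm_sq_input_le (hρ : DataModel σ σU S ρ) (hσU : 0 < σU) (hnu : 1 ≤ nu) :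
    Integrable (fun r : Rollout L nu ny => ∑ t, ‖r.1 t‖ ^ 2) ρ ∧
    ∫ r, ∑ t, ‖r.1 t‖ ^ 2 ∂ρ ≤ 2 * (L + 1) * (8 * σU ^ 2) := by
  have hi : ∀ (t : Time L) (k : Fin nu),
      Integrable (fun r : Rollout L nu ny => (r.1 t k) ^ 2) ρ := fun t k =>
    (hρ.memLp_input t k 2).integrable_sq
  have hnu' : (0 : ℝ) < nu := by exact_mod_cast hnu
  have hb : ∀ (t : Time L) (k : Fin nu), ∫ r, (r.1 t k) ^ 2 ∂ρ ≤ 8 * (σU ^ 2 / nu) := fun t k => by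
    have h := lintegral_coord_sq_le (ξ := fun r : Rollout L nu ny => r.1 t) (by fun_prop)
      (by positivity) (hρ.lintegral_exp_input_le t) k
    rw [← ofReal_integral_eq_lintegral_ofReal (hi t k) (ae_of_all _ fun r => sq_nonneg _)] at h
    exact (ENNReal.ofReal_le_ofReal_iff (by positivity)).1 h
  simp only [EuclideanSpace.norm_sq_eq, Real.norm_eq_abs, sq_abs]
  refine ⟨integrable_finsetSum _ fun t _ => integrable_finsetSum _ fun k _ => hi t k, ?_⟩
  rw [integral_finsetSum _ fun t _ => integrable_finsetSum _ fun k _ => hi t k]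
  simp_rw [integral_finsetSum _ fun k (_ : k ∈ Finset.univ) => hi _ k]
  refine (Finset.sum_le_sum fun t _ => Finset.sum_le_sum fun k _ => hb t k).trans (le_of_eq ?_)
  simp only [Finset.sum_const, Finset.card_univ, Fintype.card_fin, nsmul_eq_mul]
  push_cast
  field_simp

end DataModel

/-! ### Deterministic inequalities -/

section Deterministic

variable {L nu ny N : ℕ}

/-- Pairing of the noise with the response of `D`, summed over the rollouts. -/
noncomputable def noisePairing (D : Matrix (Time L × Fin ny) (Time L × Fin nu) ℝ)
    (X : Fin N → Rollout L nu ny) : ℝ :=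
  ∑ i, ∑ t, inner ℝ ((X i).2 t) (response D (X i).1 t)

/-- Energy of the response of `D`, summed over the rollouts. -/
noncomputable def totalEnergy (D : Matrix (Time L × Fin ny) (Time L × Fin nu) ℝ)
    (X : Fin N → Rollout L nu ny) : ℝ :=
  ∑ i, energy D (X i).1

/-- Comparison of the objective at a global optimum and at a representation of the true system. -/
theorem IsGlobalOpt.totalEnergy_le {nxs n n' : ℕ} {Ba Bb Bc lam : ℝ} (hN : 0 < N)
    {As : Matrix (Fin nxs) (Fin nxs) ℝ} {Bs : Matrix (Fin nxs) (Fin nu) ℝ}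
    {Cs : Matrix (Fin ny) (Fin nxs) ℝ} {X : Fin N → Rollout L nu ny} (hlam : 0 ≤ lam)
    {θ : DiagParam n nu ny}
    (hθ : IsGlobalOpt Ba Bb Bc lam (fun i => (X i).1) (fun i => output As Bs Cs (X i)) θ)
    {θs : DiagParam n' nu ny} (hs : θs.Bounded Ba Bb Bc) (hG : θs.G L = impulse L As Bs Cs) :
    totalEnergy (θ.G L - impulse L As Bs Cs) X
      ≤ 2 * noisePairing (θ.G L - impulse L As Bs Cs) X + 4 * N * (L + 1) * (lam * θs.reg L) := by
  have h := hθ.2 n' θs hs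
  simp only [objective, hG] at h
  have e1 : ∀ i t, ‖output As Bs Cs (X i) t - response (impulse L As Bs Cs) (X i).1 t‖ ^ 2
      = ‖(X i).2 t‖ ^ 2 := fun i t => by rw [output_eq, add_sub_cancel_left]
  have e2 : ∀ i t, ‖output As Bs Cs (X i) t - response (θ.G L) (X i).1 t‖ ^ 2
      = ‖(X i).2 t‖ ^ 2
        - 2 * inner ℝ ((X i).2 t) (response (θ.G L - impulse L As Bs Cs) (X i).1 t)
        + ‖response (θ.G L - impulse L As Bs Cs) (X i).1 t‖ ^ 2 := fun i t => by
    rw [← norm_sub_sq_real, output_eq, response_sub]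
    congr 2
    abel
  simp only [e1, e2, Finset.sum_add_distrib, Finset.sum_sub_distrib, ← Finset.mul_sum] at h
  -- The penalty at the optimum is only used through its sign; it is dropped from the left side.
  have hreg : 0 ≤ lam * θ.reg L := mul_nonneg hlam (θ.reg_nonneg L)
  have hc : (0 : ℝ) < 4 * N * (L + 1) := by positivity
  simp only [totalEnergy, noisePairing, energy]
  generalize 4 * (N : ℝ) * (L + 1) = c at h hc ⊢
  have h2 := mul_le_mul_of_nonneg_left h hc.le
  field_simp at h2
  have h3 := mul_nonneg hc.le hreg
  linarith

theorem energy_le_of_sub (M M' : Matrix (Time L × Fin ny) (Time L × Fin nu) ℝ)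
    (u : Time L → Vec nu) : energy M u ≤ 2 * energy M' u + 2 * energy (M - M') u := by
  simp only [energy, Finset.mul_sum, ← Finset.sum_add_distrib]
  refine Finset.sum_le_sum fun t _ => ?_
  rw [response_sub]
  have := norm_add_le (response M' u t) (response M u t - response M' u t)
  rw [add_sub_cancel] at this
  nlinarith [sq_nonneg (‖response M' u t‖ - ‖response M u t - response M' u t‖),
    norm_nonneg (response M u t)]

/-- Young's inequality with weights `1 + 1/2` and `1 + 2`. The factor `3/2` matters: in
`mean_energy_le` the absorbed share of the energy is `2 · 1/4 · 3/2 = 3/4 < 1`, whereas the factor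
`2` would give `1`. -/
theorem energy_le_of_sub' (M M' : Matrix (Time L × Fin ny) (Time L × Fin nu) ℝ)
    (u : Time L → Vec nu) : energy M' u ≤ 3 / 2 * energy M u + 3 * energy (M - M') u := by
  simp only [energy, Finset.mul_sum, ← Finset.sum_add_distrib]
  refine Finset.sum_le_sum fun t _ => ?_
  rw [response_sub]
  have := norm_sub_le (response M u t) (response M u t - response M' u t)
  rw [sub_sub_cancel] at this
  nlinarith [sq_nonneg (‖response M u t‖ - 2 * ‖response M u t - response M' u t‖),
    norm_nonneg (response M' u t)]

/-- Weighted Young inequality for the discretization error: a large `K` offsets the crude bound on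
the noise energy, while the energy of `D` is small enough to survive multiplication by `K`. -/
theorem noisePairing_le (D : Matrix (Time L × Fin ny) (Time L × Fin nu) ℝ)
    (X : Fin N → Rollout L nu ny) {K : ℝ} (hK : 0 < K) :
    noisePairing D X
      ≤ 1 / 2 * ((∑ i, ∑ t, ‖(X i).2 t‖ ^ 2) / K + K * totalEnergy D X) := by
  simp only [noisePairing, totalEnergy, energy, Finset.mul_sum, Finset.sum_div,
    ← Finset.sum_add_distrib]
  refine Finset.sum_le_sum fun i _ => Finset.sum_le_sum fun t _ => ?_
  refine (real_inner_le_norm _ _).trans ?_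
  set a := ‖(X i).2 t‖
  set b := ‖response D (X i).1 t‖
  have h : 1 / 2 * (a ^ 2 / K + K * b ^ 2) - a * b = (a - K * b) ^ 2 / (2 * K) := by
    field_simp
    ring
  have : 0 ≤ (a - K * b) ^ 2 / (2 * K) := by positivity
  linarith

theorem noisePairing_sub (D D' : Matrix (Time L × Fin ny) (Time L × Fin nu) ℝ)
    (X : Fin N → Rollout L nu ny) :
    noisePairing (D - D') X = noisePairing D X - noisePairing D' X := by
  simp [noisePairing, response_sub, inner_sub_right]

theorem totalEnergy_le (D : Matrix (Time L × Fin ny) (Time L × Fin nu) ℝ)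
    (X : Fin N → Rollout L nu ny) :
    totalEnergy D X ≤ specNorm D ^ 2 * ∑ i, ∑ t, ‖(X i).1 t‖ ^ 2 := by
  rw [Finset.mul_sum]
  exact Finset.sum_le_sum fun i _ => energy_le _ _

/-- The error bound that follows from the basic inequality, the lower isometry and the noise bound
at a nearby point `M'` of the net, and crude bounds on the discretization error. -/
theorem mean_energy_le {M M' : Matrix (Time L × Fin ny) (Time L × Fin nu) ℝ}
    {X : Fin N → Rollout L nu ny} {σ K b Λ m m' mD : ℝ} (hK : 0 < K)
    (hopt : totalEnergy M X ≤ 2 * noisePairing M X + Λ)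
    (hiso : N / 2 * m' ≤ totalEnergy M' X)
    (hnoise : noisePairing M' X ≤ totalEnergy M' X / 4 + b)
    (hζ : ∑ i, ∑ t, ‖(X i).2 t‖ ^ 2 ≤ K * σ ^ 2)
    (hD : K * totalEnergy (M - M') X ≤ σ ^ 2) (hK1 : 1 ≤ K)
    (hm : m ≤ 2 * m' + 2 * mD) (hmD : N * mD ≤ σ ^ 2) :
    N * m ≤ 48 * b + 98 * σ ^ 2 + 24 * Λ := by
  have hD0 : 0 ≤ totalEnergy (M - M') X := Finset.sum_nonneg fun i _ => energy_nonneg _ _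
  have h1 : noisePairing (M - M') X ≤ σ ^ 2 := by
    have h := noisePairing_le (M - M') X hK
    have h2 : (∑ i, ∑ t, ‖(X i).2 t‖ ^ 2) / K ≤ σ ^ 2 := by
      rw [div_le_iff₀ hK]; linarith
    linarith
  rw [noisePairing_sub] at h1
  have h2 : totalEnergy M' X ≤ 3 / 2 * totalEnergy M X + 3 * totalEnergy (M - M') X := by
    simp only [totalEnergy, Finset.mul_sum, ← Finset.sum_add_distrib]
    exact Finset.sum_le_sum fun i _ => energy_le_of_sub' _ _ _
  have h3 : totalEnergy (M - M') X ≤ σ ^ 2 := by nlinarith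
  -- Absorption gives `totalEnergy M X ≤ 8b + 14σ² + 4Λ`, hence `totalEnergy M' X ≤ 12b + 24σ² +
  -- 6Λ`. The isometry multiplies this by `4`, and `mD` contributes `2σ²`.
  have h4 : N * m ≤ N * (2 * m' + 2 * mD) := mul_le_mul_of_nonneg_left hm (Nat.cast_nonneg N)
  linarith

end Deterministic

/-! ### Events of high probability for independent rollouts -/

section Events

variable {L nu ny : ℕ} {σ σU : ℝ} {S : Matrix (Fin nu) (Fin nu) ℝ} {ρ : Measure (Rollout L nu ny)}
  [IsProbabilityMeasure ρ]

/-- Lower isometry for one difference of bounded systems. -/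
theorem DataModel.measure_totalEnergy_lt (hρ : DataModel σ σU S ρ) (N : ℕ) {n n' : ℕ}
    {Ba Bb Bc : ℝ} {θ : DiagParam n nu ny} {θ' : DiagParam n' nu ny}
    (hθ : θ.Bounded Ba Bb Bc) (hθ' : θ'.Bounded Ba Bb Bc) (hcond : condNum Ba Bb Bc ρ ≠ ∞)
    (hpos : 0 < (condNum Ba Bb Bc ρ).toReal) :
    (Measure.pi fun _ : Fin N => ρ) {X | totalEnergy (θ.G L - θ'.G L) X
        < N / 2 * ∫ r, energy (θ.G L - θ'.G L) r.1 ∂ρ}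
      ≤ ENNReal.ofReal (Real.exp (-(N / (8 * (condNum Ba Bb Bc ρ).toReal ^ 2)))) := by
  rw [← DiagParam.G_diff]
  obtain ⟨h1, h2⟩ := hρ.integral_energy_sq_le (hθ.diff hθ') hcond
  exact pi_measure_sum_le_half_mean ρ N (measurable_energy _) (fun r => energy_nonneg _ _)
    (hρ.integrable_energy _) h1 (by positivity) h2

/-- Bound on the pairing of the noise with one strictly causal response. -/
theorem DataModel.measure_noisePairing_gt (hρ : DataModel σ σU S ρ) (hσ : 0 < σ) (hny : 1 ≤ ny)
    (N : ℕ) {D : Matrix (Time L × Fin ny) (Time L × Fin nu) ℝ} (hD : StrictlyCausal D) (x : ℝ) :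
    (Measure.pi fun _ : Fin N => ρ) {X | totalEnergy D X / 4 + 2 * σ ^ 2 / ny * x
        < noisePairing D X}
      ≤ ENNReal.ofReal (Real.exp (-x)) := by
  have hny' : (0 : ℝ) < ny := by exact_mod_cast hny
  -- With this scale the compensator `(σ²/ny) s² ‖·‖² / 2` equals `s ‖·‖² / 4`, a quarter of the
  -- energy.
  set s : ℝ := ny / (2 * σ ^ 2) with hs
  have hs0 : 0 < s := by positivity
  have hmg := lintegral_exp_sum_inner_sub_le_one (v := σ ^ 2 / ny) (by positivity) hρ.noise_subG
    (g := fun t r => s • response D r.1 t) fun t => (hD.measurable_response t).const_smul s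
  set h : Rollout L nu ny → ℝ := fun r =>
    ∑ t, (inner ℝ (r.2 t) (s • response D r.1 t)
      - σ ^ 2 / ny * ‖s • response D r.1 t‖ ^ 2 / 2) with hh
  have hmeas : Measurable h := by
    refine Finset.measurable_sum _ fun t _ => ?_
    have h1 := measurable_response D t
    fun_prop
  have hsum : ∀ X : Fin N → Rollout L nu ny,
      ∑ i, h (X i) = s * (noisePairing D X - totalEnergy D X / 4) := fun X => by
    simp only [hh, noisePairing, totalEnergy, energy, Finset.sum_div,
      ← Finset.sum_sub_distrib, Finset.mul_sum]
    refine Finset.sum_congr rfl fun i _ => Finset.sum_congr rfl fun t _ => ?_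
    rw [inner_smul_right, norm_smul, Real.norm_eq_abs, mul_pow, sq_abs, mul_sub]
    congr 1
    rw [hs]
    field_simp
    ring
  refine (measure_mono ?_).trans ((pi_measure_sum_ge_le ρ N hmeas x).trans
    (mul_le_of_le_one_right' (pow_le_one' hmg N)))
  intro X hX
  rw [Set.mem_ofPred_eq] at hX ⊢
  rw [hsum]
  have h1 : s * (2 * σ ^ 2 / ny * x) = x := by rw [hs]; field_simp
  nlinarith

/-- Crude bound on the total energy of sub-Gaussian vectors. -/
theorem measure_sum_norm_sq_gt (N : ℕ) {d : ℕ} {v : ℝ} (hv : 0 < v)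
    {ξ : Rollout L nu ny → Time L → Vec d} (hξ : ∀ t, Measurable fun r => ξ r t)
    (h : ∀ (t : Time L) (g : Vec d), ∫⁻ r, ENNReal.ofReal (Real.exp (inner ℝ (ξ r t) g)) ∂ρ
      ≤ ENNReal.ofReal (Real.exp (v * ‖g‖ ^ 2 / 2))) {y : ℝ} (hy : 0 ≤ y) :
    (Measure.pi fun _ : Fin N => ρ) {X | N * (2 * (L + 1)) * d * (2 * v * y)
        < ∑ i, ∑ t, ‖ξ (X i) t‖ ^ 2}
      ≤ ENNReal.ofReal (N * (2 * (L + 1)) * d * (2 * Real.exp (-y))) := by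
  -- If the sum exceeds its bound, some single coordinate exceeds `2 v y`; a union bound over
  -- coordinates follows.
  have hsub : {X : Fin N → Rollout L nu ny | N * (2 * (L + 1)) * d * (2 * v * y)
        < ∑ i, ∑ t, ‖ξ (X i) t‖ ^ 2}
      ⊆ ⋃ p : Fin N × Time L × Fin d,
        Function.eval p.1 ⁻¹' {r | 2 * v * y < (ξ r p.2.1 p.2.2) ^ 2} := by
    intro X hX
    by_contra hcon
    simp only [Set.mem_iUnion, Set.mem_preimage, Function.eval, Set.mem_ofPred_eq, not_exists,
      not_lt, Prod.forall] at hcon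
    rw [Set.mem_ofPred_eq] at hX
    refine absurd hX (not_lt.2 ?_)
    simp only [EuclideanSpace.norm_sq_eq, Real.norm_eq_abs, sq_abs]
    refine (Finset.sum_le_sum fun i _ => Finset.sum_le_sum fun t _ => Finset.sum_le_sum
      fun k _ => hcon i t k).trans (le_of_eq ?_)
    simp only [Finset.sum_const, Finset.card_univ, Fintype.card_fin, nsmul_eq_mul]
    push_cast
    ring
  have hone : ∀ p : Fin N × Time L × Fin d, (Measure.pi fun _ : Fin N => ρ)
      (Function.eval p.1 ⁻¹' {r | 2 * v * y < (ξ r p.2.1 p.2.2) ^ 2})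
      ≤ ENNReal.ofReal (2 * Real.exp (-y)) := fun p => by
    have hm : Measurable fun r => ξ r p.2.1 p.2.2 := by
      have := hξ p.2.1
      fun_prop
    rw [(measurePreserving_eval (fun _ : Fin N => ρ) p.1).measure_preimage
      (measurableSet_lt measurable_const (hm.pow_const 2)).nullMeasurableSet]
    exact measure_abs_coord_gt_le (hξ p.2.1) hv (h p.2.1) p.2.2 hy
  refine (measure_mono hsub).trans ((measure_iUnion_fintype_le _ _).trans
    ((Finset.sum_le_sum fun p _ => hone p).trans (le_of_eq ?_)))
  rw [Finset.sum_const, nsmul_eq_mul, ← ENNReal.ofReal_natCast,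
    ← ENNReal.ofReal_mul (by positivity)]
  congr 1
  simp only [Finset.card_univ, Fintype.card_prod, Fintype.card_fin]
  push_cast
  ring

end Events

/-! ### Numerical bounds -/

section Numeric

variable {L N n nu ny : ℕ} {δ : ℝ}

theorem log_one_div_nonneg (hδ : 0 < δ) (hδ1 : δ ≤ 1) : 0 ≤ Real.log (1 / δ) :=
  Real.log_nonneg (by rw [le_div_iff₀ hδ]; linarith)

theorem mul_add_le_complexity (hδ : 0 < δ) (hδ1 : δ ≤ 1) :
    (n : ℝ) * (ny + nu) ≤ complexity n nu ny δ := by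
  unfold complexity
  linarith [log_one_div_nonneg hδ hδ1]

theorem sizes_le_complexity (hn : 1 ≤ n) (hnu : 1 ≤ nu) (hny : 1 ≤ ny) (hδ : 0 < δ)
    (hδ1 : δ ≤ 1) : 2 ≤ complexity n nu ny δ ∧ (n : ℝ) ≤ complexity n nu ny δ ∧
      (nu : ℝ) ≤ complexity n nu ny δ ∧ (ny : ℝ) ≤ complexity n nu ny δ := by
  have h := mul_add_le_complexity (n := n) (nu := nu) (ny := ny) hδ hδ1
  have h1 : (1 : ℝ) ≤ n := by exact_mod_cast hn
  have h2 : (1 : ℝ) ≤ nu := by exact_mod_cast hnu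
  have h3 : (1 : ℝ) ≤ ny := by exact_mod_cast hny
  refine ⟨?_, ?_, ?_, ?_⟩ <;> nlinarith

/-- Since `n (ny + nu) ≥ 2n`, the exponent dominates `2 + n + ln(1/δ)`. The right side is the share
of one of the four failure events of order `n`. -/
theorem exp_neg_two_mul_complexity_le (hn : 1 ≤ n) (hnu : 1 ≤ nu) (hny : 1 ≤ ny) (hδ : 0 < δ)
    (hδ1 : δ ≤ 1) : Real.exp (-(2 * complexity n nu ny δ)) ≤ δ / 2 ^ n / 4 := by
  have h1 : (1 : ℝ) ≤ n := by exact_mod_cast hn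
  have h2 : (1 : ℝ) ≤ nu := by exact_mod_cast hnu
  have h3 : (1 : ℝ) ≤ ny := by exact_mod_cast hny
  have hlog := log_one_div_nonneg hδ hδ1
  have he : (2 : ℝ) ≤ Real.exp 1 := by linarith [Real.exp_one_gt_d9]
  have key : 4 * 2 ^ n * (1 / δ) ≤ Real.exp (2 * complexity n nu ny δ) := by
    calc 4 * 2 ^ n * (1 / δ) ≤ Real.exp 1 ^ 2 * Real.exp 1 ^ n * (1 / δ) := by
          have : (4 : ℝ) ≤ Real.exp 1 ^ 2 := by nlinarith
          gcongr
      _ = Real.exp (2 + n + Real.log (1 / δ)) := by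
          rw [Real.exp_add, Real.exp_add, Real.exp_log (by positivity), ← Real.exp_nat_mul,
            ← Real.exp_nat_mul]
          norm_num
      _ ≤ _ := by
          refine Real.exp_le_exp.2 ?_
          unfold complexity
          nlinarith
  rw [Real.exp_neg, inv_le_comm₀ (Real.exp_pos _) (by positivity)]
  refine le_trans (le_of_eq ?_) key
  field_simp

theorem half_le_log {M : ℝ} (hM : 2 ≤ M) : 1 / 2 ≤ Real.log M :=
  le_trans (by linarith [Real.log_two_gt_d9]) (Real.log_le_log (by norm_num) hM)

/-- Cardinality of a net whose resolution is polynomial in `M`. -/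
theorem card_net_le {M B η : ℝ} (hM : 2 ≤ M) (hη : 0 < η) (hB : 0 ≤ B)
    (h : 2 * (B / η) ≤ M ^ 6) (hδ : 0 < δ) (hδ1 : δ ≤ 1) (hnu : 1 ≤ nu) :
    (Fintype.card (NetIndex n nu ny ⌊B / η⌋₊) : ℝ)
      ≤ Real.exp (14 * (complexity n nu ny δ * Real.log M)) := by
  have hl := half_le_log hM
  have h2 : (1 : ℝ) ≤ nu := by exact_mod_cast hnu
  have hfl : ((⌊B / η⌋₊ : ℕ) : ℝ) ≤ B / η := Nat.floor_le (by positivity)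
  have h6 : (1 : ℝ) ≤ M ^ 6 := one_le_pow₀ (by linarith)
  have hbase : (2 * (⌊B / η⌋₊ : ℝ) + 1) ≤ M ^ 7 := by
    have : M ^ 7 = M ^ 6 * M := by ring
    nlinarith
  rw [card_netIndex]
  push_cast
  calc (2 * (⌊B / η⌋₊ : ℝ) + 1) ^ (n * (1 + (nu + ny))) ≤ (M ^ 7) ^ (n * (1 + (nu + ny))) := by
        gcongr
    _ = Real.exp ((7 * (n * (1 + (nu + ny)) : ℕ)) * Real.log M) := by
        rw [← pow_mul, ← Real.rpow_natCast, Real.rpow_def_of_pos (by linarith)]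
        push_cast
        ring_nf
    _ ≤ _ := by
        refine Real.exp_le_exp.2 ?_
        rw [← mul_assoc]
        refine mul_le_mul_of_nonneg_right ?_ (by linarith)
        -- The coordinate `a j` is absorbed through `1 + nu + ny ≤ 2 (nu + ny)`, which doubles the
        -- exponent `7` to `14`.
        have h1 := mul_add_le_complexity (n := n) (nu := nu) (ny := ny) hδ hδ1
        have h3 : (0 : ℝ) ≤ n := Nat.cast_nonneg n
        have h4 : (0 : ℝ) ≤ ny := Nat.cast_nonneg ny
        push_cast
        nlinarith [mul_nonneg h3 h4]

/-- Discretization error of the impulse response on the net. -/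
theorem specNorm_sub_net_le {Ba Bb Bc ka η M : ℝ} (hka : 0 ≤ ka) (hη : 0 ≤ η)
    (hLip : LipschitzClass L nu ny Ba Bb Bc ka) {θ θ' : DiagParam n nu ny}
    (hθ : θ.Bounded Ba Bb Bc) (hθ' : θ'.Bounded Ba Bb Bc)
    (ha : ∑ j, (θ.a j - θ'.a j) ^ 2 ≤ n * η ^ 2)
    (hb : frobSq (θ.matB - θ'.matB) ≤ n * nu * η ^ 2)
    (hc : frobSq (θ.matC - θ'.matC) ≤ n * ny * η ^ 2)
    (hM : 1 ≤ M) (hn : (n : ℝ) ≤ M) (hnu : (nu : ℝ) ≤ M) (hny : (ny : ℝ) ≤ M) :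
    specNorm (θ.G L - θ'.G L) ≤ 3 * ka * η * M ^ 2 := by
  have hn0 : (0 : ℝ) ≤ n := Nat.cast_nonneg n
  have key : ∀ {s q : ℝ}, 0 ≤ q → q ≤ M → s ≤ n * q * η ^ 2 → √n * √s ≤ η * M ^ 2 := by
    intro s q hq0 hq hs
    rw [← Real.sqrt_mul hn0]
    refine Real.sqrt_le_iff.2 ⟨by positivity, ?_⟩
    calc (n : ℝ) * s ≤ n * (n * q * η ^ 2) := by gcongr
      _ ≤ M * (M * (M ^ 2) * η ^ 2) := by
          have : q ≤ M ^ 2 := by nlinarith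
          gcongr
      _ = (η * M ^ 2) ^ 2 := by ring
  refine (hLip n θ' θ hθ' hθ).trans ?_
  have h1 := key zero_le_one hM (by simpa using ha)
  have h2 := key (Nat.cast_nonneg nu) hnu hb
  have h3 := key (Nat.cast_nonneg ny) hny hc
  calc _ = ka * (√n * √(∑ j, (θ.a j - θ'.a j) ^ 2) + √n * √(frobSq (θ.matB - θ'.matB))
        + √n * √(frobSq (θ.matC - θ'.matC))) := by ring
    _ ≤ ka * (η * M ^ 2 + η * M ^ 2 + η * M ^ 2) := by gcongr
    _ = _ := by ring

/-- Tail probability of the union bound over all coordinates. -/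
theorem coord_tail_le {M m T d : ℝ} (hM : 2 ≤ M) (hT : T ≤ 4 * M) (hd0 : 0 ≤ d)
    (hd : d ≤ M) (hm : m ≤ M) :
    T * d * (2 * Real.exp (-(9 * M ^ 2))) ≤ Real.exp (-(2 * m)) := by
  have hM0 : 0 ≤ M := by linarith
  have h8 : 8 * M ^ 2 ≤ Real.exp (8 * M ^ 2) := by linarith [Real.add_one_le_exp (8 * M ^ 2)]
  calc T * d * (2 * Real.exp (-(9 * M ^ 2)))
      ≤ 4 * M * M * (2 * Real.exp (-(9 * M ^ 2))) := by gcongr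
    _ = 8 * M ^ 2 * Real.exp (-(9 * M ^ 2)) := by ring
    _ ≤ Real.exp (8 * M ^ 2) * Real.exp (-(9 * M ^ 2)) := by gcongr
    _ = Real.exp (-M ^ 2) := by rw [← Real.exp_add]; congr 1; ring
    _ ≤ _ := Real.exp_le_exp.2 (by nlinarith)

end Numeric

/-! ### The failure event for a fixed order -/

open scoped Matrix.Norms.L2Operator in
theorem specNorm_nonneg {m n : Type*} [Fintype m] [Fintype n] [DecidableEq n]
    (M : Matrix m n ℝ) : 0 ≤ specNorm M := norm_nonneg M

theorem measure_iUnion_le_card_mul {α ι : Type*} [MeasurableSpace α] [Fintype ι] {μ : Measure α}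
    {s : ι → Set α} {a b c : ℝ} (hs : ∀ i, μ (s i) ≤ ENNReal.ofReal b)
    (hcard : (Fintype.card ι : ℝ) ≤ a) (hb : 0 ≤ b) (hab : a * b ≤ c) :
    μ (⋃ i, s i) ≤ ENNReal.ofReal c := by
  refine (measure_iUnion_fintype_le _ _).trans ((Finset.sum_le_sum fun i _ => hs i).trans ?_)
  rw [Finset.sum_const, nsmul_eq_mul, Finset.card_univ, ← ENNReal.ofReal_natCast,
    ← ENNReal.ofReal_mul (by positivity)]
  exact ENNReal.ofReal_le_ofReal ((mul_le_mul_of_nonneg_right hcard hb).trans hab)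

/-- Failure of the lower isometry or of the noise bound at a point of the net of mesh `η`, or of
the bounds on the total energies of inputs and noise. -/
def failureEvent {L nu ny : ℕ} (N n Q : ℕ) (Ba Bb Bc η x y σ σU : ℝ)
    (Gs : Matrix (Time L × Fin ny) (Time L × Fin nu) ℝ) (ρ : Measure (Rollout L nu ny)) :
    Set (Fin N → Rollout L nu ny) :=
  (⋃ z : NetIndex n nu ny Q, {X | (netParam η z).Bounded Ba Bb Bc ∧
    totalEnergy ((netParam η z).G L - Gs) X
      < N / 2 * ∫ r, energy ((netParam η z).G L - Gs) r.1 ∂ρ}) ∪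
  (⋃ z : NetIndex n nu ny Q, {X |
    totalEnergy ((netParam η z).G L - Gs) X / 4 + 2 * σ ^ 2 / ny * x
      < noisePairing ((netParam η z).G L - Gs) X}) ∪
  {X | N * (2 * (L + 1)) * nu * (2 * (σU ^ 2 / nu) * y) < ∑ i, ∑ t, ‖(X i).1 t‖ ^ 2} ∪
  {X | N * (2 * (L + 1)) * ny * (2 * (σ ^ 2 / ny) * y) < ∑ i, ∑ t, ‖(X i).2 t‖ ^ 2}

theorem DataModel.measure_failureEvent_le {L nu ny N n n₀ Q : ℕ} {σ σU : ℝ}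
    {S : Matrix (Fin nu) (Fin nu) ℝ} {ρ : Measure (Rollout L nu ny)} [IsProbabilityMeasure ρ]
    (hρ : DataModel σ σU S ρ) {Ba Bb Bc η x y a β : ℝ} (hσ : 0 < σ) (hσU : 0 < σU)
    (hnu : 1 ≤ nu) (hny : 1 ≤ ny)
    {θ₀ : DiagParam n₀ nu ny} (hθ₀ : θ₀.Bounded Ba Bb Bc)
    (hcond : condNum Ba Bb Bc ρ ≠ ∞) (hpos : 0 < (condNum Ba Bb Bc ρ).toReal)
    (hcard : (Fintype.card (NetIndex n nu ny Q) : ℝ) ≤ a) (hx : a * Real.exp (-x) ≤ β)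
    (hN : x * (8 * (condNum Ba Bb Bc ρ).toReal ^ 2) ≤ N) (hy0 : 0 ≤ y)
    (hyu : N * (2 * (L + 1)) * nu * (2 * Real.exp (-y)) ≤ β)
    (hyy : N * (2 * (L + 1)) * ny * (2 * Real.exp (-y)) ≤ β) :
    (Measure.pi fun _ : Fin N => ρ) (failureEvent N n Q Ba Bb Bc η x y σ σU (θ₀.G L) ρ)
      ≤ ENNReal.ofReal (4 * β) := by
  have hnu0 : (0 : ℝ) < nu := by exact_mod_cast hnu
  have hny0 : (0 : ℝ) < ny := by exact_mod_cast hny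
  have hβ0 : 0 ≤ β := le_trans (by positivity) hyu
  have hfour : ENNReal.ofReal (4 * β) = ENNReal.ofReal β + ENNReal.ofReal β
      + ENNReal.ofReal β + ENNReal.ofReal β := by
    rw [← ENNReal.ofReal_add hβ0 hβ0, ← ENNReal.ofReal_add (by positivity) hβ0,
      ← ENNReal.ofReal_add (by positivity) hβ0]
    congr 1
    ring
  rw [hfour]
  refine (measure_union_le _ _).trans (add_le_add ((measure_union_le _ _).trans (add_le_add
    ((measure_union_le _ _).trans (add_le_add ?_ ?_)) ?_)) ?_)
  · refine measure_iUnion_le_card_mul (b := Real.exp (-x)) (fun z => ?_) hcard (Real.exp_pos _).le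
      hx
    by_cases hz : (netParam η z).Bounded Ba Bb Bc
    · simp only [hz, true_and]
      refine (hρ.measure_totalEnergy_lt N hz hθ₀ hcond hpos).trans
        (ENNReal.ofReal_le_ofReal (Real.exp_le_exp.2 (neg_le_neg ?_)))
      rwa [le_div_iff₀ (by positivity)]
    · simp [hz]
  · exact measure_iUnion_le_card_mul (b := Real.exp (-x))
      (fun z => hρ.measure_noisePairing_gt hσ hny N
        ((DiagParam.strictlyCausal_G L _).sub (DiagParam.strictlyCausal_G L _)) x) hcard
      (Real.exp_pos _).le hx
  · exact (measure_sum_norm_sq_gt N (by positivity) (ξ := fun r t => r.1 t) (fun t => by fun_prop)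
      hρ.lintegral_exp_input_le hy0).trans (ENNReal.ofReal_le_ofReal hyu)
  · exact (measure_sum_norm_sq_gt N (by positivity) (ξ := fun r t => r.2 t) (fun t => by fun_prop)
      hρ.lintegral_exp_noise_le hy0).trans (ENNReal.ofReal_le_ofReal hyy)

/-- Outside the failure event every global optimum satisfies the error bound. -/
theorem DataModel.error_le_of_notMem_failureEvent {L nu ny nxs N n n' : ℕ} {σ σU : ℝ}
    {S : Matrix (Fin nu) (Fin nu) ℝ} {ρ : Measure (Rollout L nu ny)} [IsProbabilityMeasure ρ]
    (hρ : DataModel σ σU S ρ) {Ba Bb Bc B η x y lam K e : ℝ} (hσU : 0 < σU)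
    (hBa : Ba ≤ B) (hBb : Bb ≤ B) (hBc : Bc ≤ B) (hη : 0 < η) (hN : 0 < N) (hnu : 1 ≤ nu)
    (hny : 1 ≤ ny) (hlam : 0 ≤ lam)
    {As : Matrix (Fin nxs) (Fin nxs) ℝ} {Bs : Matrix (Fin nxs) (Fin nu) ℝ}
    {Cs : Matrix (Fin ny) (Fin nxs) ℝ} {X : Fin N → Rollout L nu ny}
    (hX : X ∉ failureEvent N n ⌊B / η⌋₊ Ba Bb Bc η x y σ σU (impulse L As Bs Cs) ρ)
    (hnet : ∀ θ θ' : DiagParam n nu ny, θ.Bounded Ba Bb Bc → θ'.Bounded Ba Bb Bc →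
      ∑ j, (θ.a j - θ'.a j) ^ 2 ≤ n * η ^ 2 → frobSq (θ.matB - θ'.matB) ≤ n * nu * η ^ 2 →
      frobSq (θ.matC - θ'.matC) ≤ n * ny * η ^ 2 → specNorm (θ.G L - θ'.G L) ≤ e)
    (hK1 : 1 ≤ K) (heK : e * σU * K ≤ σ) (hyK : N * (2 * (L + 1)) * (2 * y) ≤ K)
    (hTK : N * (2 * (L + 1)) * 8 ≤ K)
    {θ : DiagParam n nu ny}
    (hθ : IsGlobalOpt Ba Bb Bc lam (fun i => (X i).1) (fun i => output As Bs Cs (X i)) θ)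
    {θs : DiagParam n' nu ny} (hs : θs.Bounded Ba Bb Bc) (hG : θs.G L = impulse L As Bs Cs) :
    N * ∫ r, energy (θ.G L - impulse L As Bs Cs) r.1 ∂ρ
      ≤ 48 * (2 * σ ^ 2 / ny * x) + 98 * σ ^ 2 + 24 * (4 * N * (L + 1) * (lam * θs.reg L)) := by
  have hnu0 : (0 : ℝ) < nu := by exact_mod_cast hnu
  have hny0 : (0 : ℝ) < ny := by exact_mod_cast hny
  have hK0 : 0 < K := by linarith
  simp only [failureEvent, Set.mem_union, not_or, Set.mem_iUnion, not_exists, Set.mem_ofPred_eq,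
    not_and, not_lt] at hX
  obtain ⟨⟨⟨hA, hB⟩, hU⟩, hV⟩ := hX
  obtain ⟨z, hz, h1, h2, h3⟩ := exists_netParam hη hBa hBb hBc hθ.1
  have hD := hnet θ _ hθ.1 hz h1 h2 h3
  have hopt := hθ.totalEnergy_le hN hlam hs hG
  have hiso := hA z hz
  have hnoise := hB z
  clear hA hB h1 h2 h3 hnet hθ hz
  generalize (netParam η z).G L = M' at hD hiso hnoise
  generalize θ.G L = M at hD hopt ⊢
  generalize impulse L As Bs Cs = Gs at hopt hiso hnoise ⊢
  set s := specNorm (M - M') with hs_def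
  have hs0 : 0 ≤ s := specNorm_nonneg _
  -- One factor `K` bounds the input energy, the other is the Young weight. The mesh is fine enough
  -- to beat both.
  have hsK : s ^ 2 * (K * σU ^ 2) * K ≤ σ ^ 2 := by
    have h4 : s * σU * K ≤ σ := le_trans (by gcongr) heK
    calc _ = (s * σU * K) ^ 2 := by ring
      _ ≤ σ ^ 2 := pow_le_pow_left₀ (by positivity) h4 2
  have hyK' : ∀ {r : ℝ} {d : ℕ}, (0 : ℝ) < d →
      N * (2 * (L + 1)) * d * (2 * (r ^ 2 / d) * y) ≤ K * r ^ 2 := by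
    intro r d hd
    calc N * (2 * (L + 1)) * d * (2 * (r ^ 2 / d) * y)
        = N * (2 * (L + 1)) * (2 * y) * r ^ 2 := by field_simp
      _ ≤ K * r ^ 2 := by gcongr
  have hsub : M - Gs - (M' - Gs) = M - M' := by abel
  obtain ⟨hUi, hUm⟩ := hρ.integral_sum_norm_sq_input_le hσU hnu
  refine mean_energy_le (M := M - Gs) (M' := M' - Gs) (X := X) (K := K)
    (m' := ∫ r, energy (M' - Gs) r.1 ∂ρ) (mD := ∫ r, energy (M - M') r.1 ∂ρ) hK0 hopt hiso hnoise
    (hV.trans (hyK' hny0)) ?_ hK1 ?_ ?_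
  · rw [hsub]
    calc _ ≤ K * (s ^ 2 * (K * σU ^ 2)) := by
          refine mul_le_mul_of_nonneg_left ((totalEnergy_le _ _).trans ?_) hK0.le
          exact mul_le_mul_of_nonneg_left (hU.trans (hyK' hnu0)) (sq_nonneg _)
      _ ≤ σ ^ 2 := by linarith
  · rw [← integral_const_mul, ← integral_const_mul, ← integral_add
      ((hρ.integrable_energy _).const_mul _) ((hρ.integrable_energy _).const_mul _)]
    refine integral_mono (hρ.integrable_energy _) (((hρ.integrable_energy _).const_mul _).add
      ((hρ.integrable_energy _).const_mul _)) fun r => ?_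
    have := energy_le_of_sub (M - Gs) (M' - Gs) r.1
    rwa [hsub] at this
  · have h6 : ∫ r, energy (M - M') r.1 ∂ρ ≤ s ^ 2 * (2 * (L + 1) * (8 * σU ^ 2)) := by
      refine (integral_mono (hρ.integrable_energy _) (hUi.const_mul _)
        fun r => energy_le _ _).trans ?_
      rw [integral_const_mul]
      exact mul_le_mul_of_nonneg_left hUm (sq_nonneg _)
    calc _ ≤ N * (s ^ 2 * (2 * (L + 1) * (8 * σU ^ 2))) := by gcongr
      _ = s ^ 2 * ((N * (2 * (L + 1)) * 8 * 1) * σU ^ 2) := by ring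
      _ ≤ s ^ 2 * ((K * K) * σU ^ 2) := by gcongr
      _ ≤ σ ^ 2 := by linarith

/-- With probability at least `1 - δ / 2 ^ n`, all global optima of order `n` satisfy the error
bound relative to every representation of the true system. -/
theorem DataModel.measure_exists_globalOpt_error_gt {L nu ny nxs N n : ℕ} {σ σU : ℝ}
    {S : Matrix (Fin nu) (Fin nu) ℝ} {ρ : Measure (Rollout L nu ny)} [IsProbabilityMeasure ρ]
    (hρ : DataModel σ σU S ρ) {Ba Bb Bc B ka δ lam : ℝ} (hσ : 0 < σ) (hσU : 0 < σU)
    (hB0 : 0 < B) (hBa : Ba ≤ B) (hBb : Bb ≤ B) (hBc : Bc ≤ B) (hka : 0 < ka) (hL : 1 ≤ L)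
    (hNL : 2 ≤ N * L) (hnu : 1 ≤ nu) (hny : 1 ≤ ny) (hn : 1 ≤ n) (hδ : 0 < δ) (hδ1 : δ ≤ 1)
    (hlam : 0 ≤ lam) (hLip : LipschitzClass L nu ny Ba Bb Bc ka)
    (As : Matrix (Fin nxs) (Fin nxs) ℝ) (Bs : Matrix (Fin nxs) (Fin nu) ℝ)
    (Cs : Matrix (Fin ny) (Fin nxs) ℝ)
    (hcond : condNum Ba Bb Bc ρ ≠ ∞) (hpos : 0 < (condNum Ba Bb Bc ρ).toReal)
    (hmN : complexity n nu ny δ ≤ N) (hκ : 432 * B * ka * σU ≤ N * σ)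
    (hN : 144 * (condNum Ba Bb Bc ρ).toReal ^ 2
      * (complexity n nu ny δ * Real.log (N * L)) ≤ N) :
    (Measure.pi fun _ : Fin N => ρ) {X | ¬ ∀ θ : DiagParam n nu ny,
        IsGlobalOpt Ba Bb Bc lam (fun i => (X i).1) (fun i => output As Bs Cs (X i)) θ →
        ∀ (n' : ℕ) (θs : DiagParam n' nu ny), θs.Bounded Ba Bb Bc →
          θs.G L = impulse L As Bs Cs →
          N * ∫ r, energy (θ.G L - impulse L As Bs Cs) r.1 ∂ρ
            ≤ 48 * (2 * σ ^ 2 / ny * (18 * (complexity n nu ny δ * Real.log (N * L))))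
              + 98 * σ ^ 2 + 24 * (4 * N * (L + 1) * (lam * θs.reg L))}
      ≤ ENNReal.ofReal (δ / 2 ^ n) := by
  -- Without a bounded representation of `G*` the event is empty. Otherwise one fixed `θ₀` suffices
  -- for the probability bound: the failure event depends on `G*` only, so the conclusion holds for
  -- all `θs` at once.
  by_cases hex : ∃ (n₀ : ℕ) (θ₀ : DiagParam n₀ nu ny), θ₀.Bounded Ba Bb Bc ∧
      θ₀.G L = impulse L As Bs Cs
  swap
  · refine (measure_mono_null (t := ∅) (fun X hX => ?_) measure_empty).trans_le zero_le
    rw [Set.mem_ofPred_eq] at hX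
    exact hX fun θ _ n' θs hs hG => absurd ⟨n', θs, hs, hG⟩ hex
  obtain ⟨n₀, θ₀, hθ₀, hG₀⟩ := hex
  obtain ⟨hm2, hnm, hnum, hnym⟩ := sizes_le_complexity hn hnu hny hδ hδ1
  have hδn := exp_neg_two_mul_complexity_le (n := n) hn hnu hny hδ hδ1
  have hM2 : (2 : ℝ) ≤ N * L := by exact_mod_cast hNL
  have hL1 : (1 : ℝ) ≤ L := by exact_mod_cast hL
  have hN0 : (0 : ℝ) < N := by linarith
  have hNM : (N : ℝ) ≤ N * L := by nlinarith
  have hTM : (N : ℝ) * (2 * (L + 1)) ≤ 4 * (N * L) := by nlinarith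
  have hcard : ∀ η : ℝ, 0 < η → 2 * (B / η) ≤ ((N : ℝ) * L) ^ 6 →
      (Fintype.card (NetIndex n nu ny ⌊B / η⌋₊) : ℝ)
        ≤ Real.exp (14 * (complexity n nu ny δ * Real.log (N * L))) := fun η hη h =>
    card_net_le hM2 hη hB0.le h hδ hδ1 hnu
  generalize complexity n nu ny δ = m at *
  generalize (N : ℝ) * L = M at *
  have hl2 : 1 / 2 ≤ Real.log M := half_le_log hM2
  generalize Real.log M = ℓ at *
  have hM0 : 0 < M := by linarith
  have hM3 : (8 : ℝ) ≤ M ^ 3 := by linarith [pow_le_pow_left₀ (by norm_num) hM2 3]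
  have hMM3 : M ≤ M ^ 3 := by
    have : M ^ 3 = M * M ^ 2 := by ring
    nlinarith
  have hmM : m ≤ M := hmN.trans hNM
  -- Chosen so that `e σU K = σ` for `e = 3 ka η M²` and `K = 72 M³`. The value of `K` comes from `y
  -- = 9 M²` and at most `4M` pairs of rollout and time.
  set η : ℝ := σ / (216 * ka * σU * M ^ 5) with hη
  have hη0 : 0 < η := by positivity
  have hres : 2 * (B / η) ≤ M ^ 6 := by
    have e : 2 * (B / η) = 432 * B * ka * σU / σ * M ^ 5 := by
      rw [hη]; field_simp; norm_num
    have h1 : 432 * B * ka * σU / σ ≤ M := (div_le_iff₀ hσ).2 (hκ.trans (by gcongr))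
    rw [e, show M ^ 6 = M * M ^ 5 by ring]
    gcongr
  -- The margin `18 - 14 = 4` gives `exp(-4mℓ) ≤ exp(-2m)`, as `ℓ ≥ 1/2`. The isometry with `x =
  -- 18mℓ` then requires `N ≥ 8 · 18 cond² mℓ`, the origin of `144`.
  have hx : Real.exp (14 * (m * ℓ)) * Real.exp (-(18 * (m * ℓ))) ≤ δ / 2 ^ n / 4 := by
    rw [← Real.exp_add]
    exact le_trans (Real.exp_le_exp.2 (by nlinarith)) hδn
  have hmeas := hρ.measure_failureEvent_le (n := n) (η := η) (y := 9 * M ^ 2) hσ hσU hnu hny hθ₀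
    hcond hpos (hcard η hη0 hres) hx (by linarith) (by positivity)
    ((coord_tail_le hM2 hTM (Nat.cast_nonneg _) (hnum.trans hmM) hmM).trans hδn)
    ((coord_tail_le hM2 hTM (Nat.cast_nonneg _) (hnym.trans hmM) hmM).trans hδn)
  rw [mul_div_cancel₀ _ (by norm_num : (4 : ℝ) ≠ 0), hG₀] at hmeas
  refine le_trans (measure_mono fun X hX => ?_) hmeas
  by_contra hcon
  rw [Set.mem_ofPred_eq] at hX
  refine hX fun θ hθ n' θs hs hG => ?_
  refine hρ.error_le_of_notMem_failureEvent (K := 72 * M ^ 3) (e := 3 * ka * η * M ^ 2) hσU hBa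
    hBb hBc hη0 (by exact_mod_cast hN0) hnu hny hlam hcon ?_ (by linarith) ?_ ?_ (by linarith)
    hθ hs hG
  · exact fun θ θ' h h' ha hb hc => specNorm_sub_net_le hka.le hη0.le hLip h h' ha hb hc
      (by linarith) (hnm.trans hmM) (hnum.trans hmM) (hnym.trans hmM)
  · refine le_of_eq ?_
    rw [hη]
    field_simp
    norm_num
  · calc (N : ℝ) * (2 * (L + 1)) * (2 * (9 * M ^ 2)) ≤ 4 * M * (2 * (9 * M ^ 2)) := by gcongr
      _ = 72 * M ^ 3 := by ring

/-! ### Assembly -/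

/-- For `0 < k < ∞` the inequality in the regularizer value is equivalent to a lower bound `a / k -
s ≤ r` with truncated subtraction, so it passes to the infimum. This covers the empty family, where
the infimum is `∞`. -/
theorem le_mul_add_optReg {L nu ny : ℕ} {Ba Bb Bc : ℝ}
    {Gs : Matrix (Time L × Fin ny) (Time L × Fin nu) ℝ} {a k s : ℝ≥0∞} (hk : k ≠ 0) (hk' : k ≠ ∞)
    (h : ∀ (n : ℕ) (θ : DiagParam n nu ny), θ.Bounded Ba Bb Bc → θ.G L = Gs →
      a ≤ k * (s + ENNReal.ofReal (θ.reg L))) :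
    a ≤ k * (s + optReg L Ba Bb Bc Gs) := by
  have key : ∀ r : ℝ≥0∞, a ≤ k * (s + r) ↔ a / k - s ≤ r := fun r => by
    rw [tsub_le_iff_left, ENNReal.div_le_iff hk hk', mul_comm]
  rw [key, optReg]
  exact le_iInf fun n => le_iInf fun θ => le_iInf fun hθ => le_iInf fun hG =>
    (key _).1 (h n θ hθ hG)

/-- The error bound at a fixed representation, in the normalization of the main theorem. -/
theorem error_div_le {L N ny : ℕ} {σ lam r E m ℓ Clam αlam : ℝ} (hL : 1 ≤ L) (hN : 0 < N)
    (hny : 1 ≤ ny) (hm : 2 ≤ m) (hl : 1 / 2 ≤ ℓ) (hr : 0 ≤ r) (hClam : 0 < Clam) (hαlam : 0 ≤ αlam)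
    (hlam : lam ≤ Clam * (m / (N * L)) * ℓ ^ αlam)
    (h : N * E ≤ 48 * (2 * σ ^ 2 / ny * (18 * (m * ℓ))) + 98 * σ ^ 2
      + 24 * (4 * N * (L + 1) * (lam * r))) :
    E / (2 * (L + 1)) ≤ (913 * 2 ^ αlam + 96 * Clam) * (m / (N * L)) * ℓ ^ (αlam + 1)
      * (σ ^ 2 + r) := by
  have hL0 : (0 : ℝ) < L := by exact_mod_cast hL
  have hN0 : (0 : ℝ) < N := by exact_mod_cast hN
  have hny1 : (1 : ℝ) ≤ ny := by exact_mod_cast hny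
  have hl0 : 0 < ℓ := by linarith
  have hml : 1 ≤ m * ℓ := by nlinarith
  have hpow : ℓ ^ (αlam + 1) = ℓ ^ αlam * ℓ := Real.rpow_add_one hl0.ne' _
  have hp0 : 0 < ℓ ^ αlam := Real.rpow_pos_of_pos hl0 _
  -- Since `2ℓ ≥ 1`, lower powers of `ℓ` are raised to the common exponent `αlam + 1` at the price
  -- of powers of `2`.
  have h1 : ℓ ≤ 2 ^ αlam * ℓ ^ (αlam + 1) := by
    have : 1 ≤ (2 : ℝ) ^ αlam * ℓ ^ αlam := by
      rw [← Real.mul_rpow (by norm_num) hl0.le]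
      exact Real.one_le_rpow (by linarith) hαlam
    rw [hpow, ← mul_assoc]
    nlinarith
  have h2 : ℓ ^ αlam ≤ 2 * ℓ ^ (αlam + 1) := by rw [hpow]; nlinarith
  have h3 : 2 * σ ^ 2 / ny ≤ 2 * σ ^ 2 := div_le_self (by positivity) hny1
  -- `1826 = 48 · 2 · 18 + 98`, the last summand being absorbed by `mℓ ≥ 1`.
  have h4 : N * E ≤ 1826 * (σ ^ 2 * (m * ℓ)) + 96 * N * (L + 1) * (lam * r) := by
    have h5 : 2 * σ ^ 2 / ny * (18 * (m * ℓ)) ≤ 2 * σ ^ 2 * (18 * (m * ℓ)) := by gcongr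
    have h6 : σ ^ 2 * 1 ≤ σ ^ 2 * (m * ℓ) := by gcongr
    linarith
  have h7 : E / (2 * (L + 1)) ≤ 913 * (m / (N * L)) * ℓ * σ ^ 2 + 48 * (lam * r) := by
    rw [div_le_iff₀ (by positivity)]
    refine le_of_mul_le_mul_left (h4.trans ?_) hN0
    have h8 : N * ((913 * (m / (N * L)) * ℓ * σ ^ 2 + 48 * (lam * r)) * (2 * (L + 1)))
        = 1826 * (σ ^ 2 * (m * ℓ)) * ((L + 1) / L) + 96 * N * (L + 1) * (lam * r) := by
      field_simp
      ring
    rw [h8]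
    have h9 : 1 ≤ ((L : ℝ) + 1) / L := by rw [le_div_iff₀ hL0]; linarith
    have h10 : 0 ≤ 1826 * (σ ^ 2 * (m * ℓ)) := by positivity
    nlinarith
  have hq : 0 < m / (N * L) := by positivity
  have h11 : 913 * (m / (N * L)) * ℓ * σ ^ 2
      ≤ 913 * (m / (N * L)) * (2 ^ αlam * ℓ ^ (αlam + 1)) * σ ^ 2 := by gcongr
  have h12 : lam * r ≤ Clam * (m / (N * L)) * (2 * ℓ ^ (αlam + 1)) * r := by
    refine mul_le_mul_of_nonneg_right (hlam.trans ?_) hr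
    gcongr
  have h13 : 0 ≤ 913 * 2 ^ αlam * (m / (N * L)) * ℓ ^ (αlam + 1) * r := by positivity
  have h14 : 0 ≤ 96 * Clam * (m / (N * L)) * ℓ ^ (αlam + 1) * σ ^ 2 := by positivity
  refine h7.trans ?_
  nlinarith

/-- Stated for arbitrary `s`, because the events quantify over uncountably many parameters and need
not be measurable; for outer measure this inequality suffices. -/
theorem measure_preimage_le_pi {E Ω : Type*} [MeasurableSpace E] [MeasurableSpace Ω] {N : ℕ}
    {μ : Measure Ω} [IsProbabilityMeasure μ] {ρ : Measure E} {X : Fin N → Ω → E}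
    (hX : ∀ i, HasLaw (X i) ρ μ) (hind : iIndepFun X μ) (s : Set (Fin N → E)) :
    μ ((fun ω i => X i ω) ⁻¹' s) ≤ (Measure.pi fun _ => ρ) s := by
  have h := (iIndepFun_iff_map_fun_eq_pi_map fun i => (hX i).aemeasurable).1 hind
  simp only [(hX _).map_eq] at h
  rw [← h]
  exact Measure.le_map_apply (aemeasurable_pi_lambda _ fun i => (hX i).aemeasurable) s

theorem tsum_ofReal_div_two_pow {δ : ℝ} (hδ : 0 ≤ δ) :
    ∑' n : ℕ, ENNReal.ofReal (δ / 2 ^ (n + 1)) = ENNReal.ofReal δ := by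
  have e : ∀ n : ℕ, δ / 2 ^ (n + 1) = δ / 2 / 2 ^ n := fun n => by
    rw [pow_succ', div_div]
  simp_rw [e]
  rw [← ENNReal.ofReal_tsum_of_nonneg (fun n => by positivity) (summable_geometric_two' δ),
    tsum_geometric_two']

end SysId

open SysId in
theorem mainTheorem1
    (Clam αlam : ℝ) (hClam : 0 < Clam) (hαlam : 0 ≤ αlam) :
    ∃ C α : ℝ, 0 < C ∧ 0 ≤ α ∧
    ∀ σ σU Ba Bb Bc ka : ℝ, 0 < σ → 0 < σU → 0 < Ba → 0 < Bb → 0 < Bc → 0 < ka →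
    ∃ c : ℝ, 0 < c ∧
    ∀ (L N nu ny nxs : ℕ) (δ lam : ℝ), 1 ≤ L → 2 ≤ N * L → 1 ≤ nu → 1 ≤ ny →
      0 < δ → δ ≤ 1 → 0 ≤ lam →
      LipschitzClass L nu ny Ba Bb Bc ka →
    ∀ (As : Matrix (Fin nxs) (Fin nxs) ℝ) (Bs : Matrix (Fin nxs) (Fin nu) ℝ)
      (Cs : Matrix (Fin ny) (Fin nxs) ℝ) (S : Matrix (Fin nu) (Fin nu) ℝ)
      (ρ : Measure (Rollout L nu ny)) [IsProbabilityMeasure ρ], DataModel σ σU S ρ →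
    ∀ (Ω : Type*) [MeasurableSpace Ω] (μ : Measure Ω) [IsProbabilityMeasure μ]
      (X : Fin N → Ω → Rollout L nu ny), (∀ i, HasLaw (X i) ρ μ) → iIndepFun X μ →
    μ {ω | ∀ (n : ℕ) (θ : DiagParam n nu ny), 1 ≤ n →
        lam ≤ Clam * (complexity n nu ny δ / (N * L)) * Real.log (N * L) ^ αlam →
        ENNReal.ofReal c * condNum Ba Bb Bc ρ ^ 2 * ENNReal.ofReal (complexity n nu ny δ)
          ≤ ENNReal.ofReal (N / Real.log (N * L)) →
        IsGlobalOpt Ba Bb Bc lam (fun i => (X i ω).1) (fun i => output As Bs Cs (X i ω)) θ →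
        ENNReal.ofReal
            (frobSq ((θ.G L - impulse L As Bs Cs) * covSqrt L S) / (2 * (L + 1)))
          ≤ ENNReal.ofReal (C * (complexity n nu ny δ / (N * L)) * Real.log (N * L) ^ α)
              * (ENNReal.ofReal (σ ^ 2) + optReg L Ba Bb Bc (impulse L As Bs Cs))}ᶜ
      ≤ ENNReal.ofReal δ := by
  refine ⟨913 * 2 ^ αlam + 96 * Clam, αlam + 1, by positivity, by positivity, ?_⟩
  intro σ σU Ba Bb Bc ka hσ hσU hBa hBb hBc hka
  set B := max Ba (max Bb Bc) with hB
  have hB0 : 0 < B := lt_max_of_lt_left hBa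
  -- The summand `144` serves the lower isometry over the net. The other one forces `N` to be at
  -- least `432 B ka σU / σ`, which keeps the resolution of the net below `(NL)^6`.
  refine ⟨144 + 432 * B * ka * σU / σ, by positivity, ?_⟩
  intro L N nu ny nxs δ lam hL hNL hnu hny hδ hδ1 hlam hLip As Bs Cs S ρ _ hρ Ω _ μ _ X hX hind
  have hN : 0 < N := Nat.pos_of_ne_zero fun h => by simp [h] at hNL
  have hN0 : (0 : ℝ) < N := by exact_mod_cast hN
  have hM2 : (2 : ℝ) ≤ N * L := by exact_mod_cast hNL
  have hl2 : 1 / 2 ≤ Real.log (N * L) := half_le_log hM2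
  have hk : ∀ n, 1 ≤ n → 0 < (913 * 2 ^ αlam + 96 * Clam) * (complexity n nu ny δ / (N * L))
      * Real.log (N * L) ^ (αlam + 1) := fun n hn => by
    have := (sizes_le_complexity (n := n) hn hnu hny hδ hδ1).1
    have hl0 : 0 < Real.log (N * L) := by linarith
    have : 0 < complexity n nu ny δ := by linarith
    positivity
  simp only [hρ.frobSq_mul_covSqrt]
  -- Below `1` the sample size condition need not bound `N` from below, but then every response
  -- vanishes almost surely and the error is zero.
  by_cases hcond1 : condNum Ba Bb Bc ρ < 1
  · refine (measure_mono_null (t := ∅) (fun ω hω => ?_) measure_empty).trans_le zero_le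
    rw [Set.mem_compl_iff, Set.mem_ofPred_eq] at hω
    refine hω fun n θ hn _ _ hθ => ?_
    refine le_mul_add_optReg (ENNReal.ofReal_pos.2 (hk n hn)).ne' ENNReal.ofReal_ne_top
      fun n' θs hs hG => ?_
    rw [← hG, ← DiagParam.G_diff, hρ.integral_energy_eq_zero (hθ.1.diff hs) hcond1]
    simp
  have hcond1 := not_lt.1 hcond1
  have hbad : ∀ n, μ {ω | ¬ ∀ θ : DiagParam (n + 1) nu ny,
        lam ≤ Clam * (complexity (n + 1) nu ny δ / (N * L)) * Real.log (N * L) ^ αlam →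
        ENNReal.ofReal (144 + 432 * B * ka * σU / σ) * condNum Ba Bb Bc ρ ^ 2
          * ENNReal.ofReal (complexity (n + 1) nu ny δ)
          ≤ ENNReal.ofReal (N / Real.log (N * L)) →
        IsGlobalOpt Ba Bb Bc lam (fun i => (X i ω).1) (fun i => output As Bs Cs (X i ω)) θ →
        ENNReal.ofReal ((∫ r, energy (θ.G L - impulse L As Bs Cs) r.1 ∂ρ) / (2 * (L + 1)))
          ≤ ENNReal.ofReal ((913 * 2 ^ αlam + 96 * Clam)
              * (complexity (n + 1) nu ny δ / (N * L)) * Real.log (N * L) ^ (αlam + 1))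
              * (ENNReal.ofReal (σ ^ 2) + optReg L Ba Bb Bc (impulse L As Bs Cs))}
      ≤ ENNReal.ofReal (δ / 2 ^ (n + 1)) := by
    intro n
    have hn : 1 ≤ n + 1 := Nat.le_add_left 1 n
    have hm2 := (sizes_le_complexity (n := n + 1) hn hnu hny hδ hδ1).1
    have hkn := hk (n + 1) hn
    set m := complexity (n + 1) nu ny δ with hm
    by_cases hass : lam ≤ Clam * (m / (N * L)) * Real.log (N * L) ^ αlam ∧
        ENNReal.ofReal (144 + 432 * B * ka * σU / σ) * condNum Ba Bb Bc ρ ^ 2 * ENNReal.ofReal m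
          ≤ ENNReal.ofReal (N / Real.log (N * L))
    swap
    · refine (measure_mono_null (t := ∅) (fun ω hω => ?_) measure_empty).trans_le zero_le
      rw [Set.mem_ofPred_eq] at hω
      exact hω fun θ h1 h2 => absurd ⟨h1, h2⟩ hass
    obtain ⟨hlam', hN'⟩ := hass
    set c := 144 + 432 * B * ka * σU / σ with hc
    have hκ0 : 0 < 432 * B * ka * σU / σ := by positivity
    have hcond : condNum Ba Bb Bc ρ ≠ ∞ := by
      intro h
      rw [h, ENNReal.top_pow two_ne_zero, ENNReal.mul_top (by simp; linarith),
        ENNReal.top_mul (by simp; linarith)] at hN'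
      exact absurd hN' (by simp)
    have hκ1 : 1 ≤ (condNum Ba Bb Bc ρ).toReal := by
      simpa using ENNReal.toReal_mono hcond hcond1
    have hreal : c * (condNum Ba Bb Bc ρ).toReal ^ 2 * m ≤ N / Real.log (N * L) := by
      rw [← ENNReal.ofReal_toReal hcond, ← ENNReal.ofReal_pow (by positivity),
        ← ENNReal.ofReal_mul (by linarith), ← ENNReal.ofReal_mul (by positivity)] at hN'
      exact (ENNReal.ofReal_le_ofReal_iff (by positivity)).1 hN'
    rw [le_div_iff₀ (by linarith)] at hreal
    set κ := (condNum Ba Bb Bc ρ).toReal with hκ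
    set ℓ := Real.log (N * L) with hℓ
    have hκ2 : 1 ≤ κ ^ 2 := one_le_pow₀ hκ1
    have hml : m * (1 / 2) ≤ m * ℓ := by gcongr
    have hc0 : 144 ≤ c := by linarith
    -- From `cond ≥ 1` and `ℓ ≥ 1/2`. With `m ≥ 2` this yields both `m ≤ N` and `c ≤ N`.
    have hcm : c * (m * (1 / 2)) ≤ N := by
      calc c * (m * (1 / 2)) = c * 1 * m * (1 / 2) := by ring
        _ ≤ c * κ ^ 2 * m * ℓ := by gcongr
        _ ≤ N := hreal
    have hmN : m ≤ N := by nlinarith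
    have hκN : 432 * B * ka * σU ≤ N * σ := by
      rw [← div_le_iff₀ hσ]
      nlinarith
    have hN144 : 144 * κ ^ 2 * (m * ℓ) ≤ N := by
      calc 144 * κ ^ 2 * (m * ℓ) ≤ c * κ ^ 2 * (m * ℓ) := by gcongr
        _ ≤ (N : ℝ) := by linarith
    have hmain := hρ.measure_exists_globalOpt_error_gt hσ hσU hB0 (le_max_left _ _)
      ((le_max_left _ _).trans (le_max_right _ _)) ((le_max_right _ _).trans (le_max_right _ _))
      hka hL hNL hnu hny hn hδ hδ1 hlam hLip As Bs Cs hcond (by linarith) hmN hκN hN144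
    refine le_trans (measure_mono fun ω hω => ?_) ((measure_preimage_le_pi hX hind _).trans hmain)
    rw [Set.mem_preimage, Set.mem_ofPred_eq]
    rw [Set.mem_ofPred_eq] at hω
    refine fun hgood => hω fun θ _ _ hθ => ?_
    refine le_mul_add_optReg (ENNReal.ofReal_pos.2 hkn).ne' ENNReal.ofReal_ne_top
      fun n' θs hs hG => ?_
    have hr := θs.reg_nonneg L
    rw [← ENNReal.ofReal_add (by positivity) hr, ← ENNReal.ofReal_mul hkn.le]
    exact ENNReal.ofReal_le_ofReal (error_div_le hL hN hny hm2 hl2 hr hClam hαlam hlam'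
      (hgood θ hθ n' θs hs hG))
  -- Union over the orders `n + 1`, whose failure probabilities `δ / 2 ^ (n + 1)` sum to `δ`.
  refine le_trans (measure_mono ?_) ((measure_iUnion_le _).trans
    ((ENNReal.tsum_le_tsum hbad).trans (tsum_ofReal_div_two_pow hδ.le).le))
  intro ω hω
  by_contra hcon
  simp only [Set.mem_iUnion, Set.mem_ofPred_eq, not_exists, not_not] at hcon
  refine hω fun n θ hn h1 h2 hθ => ?_
  obtain ⟨k, rfl⟩ : ∃ k, n = k + 1 := ⟨n - 1, by omega⟩
  exact hcon k θ h1 h2 hθ
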